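/- Let $V$ be a finite set of points in the plane in general position (no three collinear, no four cocircular). For $v\in V$ let $N_v=\{u\in V:|uv|\le 1\}$ and let $LDT(v)$ be the Delaunay triangulation of $N_v$: distinct $u,w\in N_v$ form an edge iff there is a disk $D$ with $N_v\cap\partial D=\{u,w\}$ and $N_v\cap\mathrm{int}(D)=\emptyset$ (such a $D$ is denoted $Del_v(u,w)$), and three points of $N_v$ form a triangular face iff the disk with these points on its boundary has no point of $N_v$ in its interior. Two segments cross if they are not collinear and their relative interiors meet. $D(c;r)$ denotes the closed disk with center $c$ and radius $r$. *Algorithm PLDG.* Each $v\in V$ starts with $E(v)$, the set of edges of $LDT(v)$ incident on $v$. Let $\Delta_v$ be the set of triangular faces $\Delta(u,v,w)$ of $LDT(v)$ with $\angle uvw>\pi/3$. If $\Delta_v\neq\emptyset$, then $v$ broadcasts to all points of $N_v$ one sequence $(v,c_1,\dots,c_k)$, where $c_1,\dots,c_k$ are the circumcenters of the triangles in $\Delta_v$. Then, for each sequence $(x,c'_1,\dots,c'_m)$ received and each $i=1,\dots,m$, $v$ does the following. If $\partial D(c'_i;|c'_ix|)$ contains exactly two points of $N_v$, let $p$ be the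 one different from $x$, let $arc_i=\partial D(c'_i;|c'_ix|)\setminus D(v;1)$, and choose an arbitrary $z'\in arc_i$ with $|xz'|\le 1$ or $|pz'|\le 1$; then, for each edge $(v,y)$ in the current $E(v)$, choose an arbitrary disk $Del_v(v,y)$, and remove $(v,y)$ from $E(v)$ if $arc_i\subseteq\mathrm{int}(Del_v(v,y))$ and $vy$ crosses $xz'$ or $pz'$. *Algorithm PLDG$'$.* The same with edge sets $E'(v)$ and the following changes. The sequence broadcast by $v$ is $(c_1,\dots,c_k)$, without $v$. For a received center $c'_i$, $v$ chooses a point $x'\in N_v\setminus\{v\}$ closest to $c'_i$ and uses $x'$ in place of $x$: if $\partial D(c'_i;|c'_ix'|)$ contains exactly two points of $N_v$, let $p'$ be the one different from $x'$, let $arc_i=\partial D(c'_i;|c'_ix'|)\setminus D(v;1)$ and $Z=\{z'\in arc_i:|x'z'|\le1\text{ or }|p'z'|\le1\}$; if $Z\ne\emptyset$, choose an arbitrary $z'\in Z$, and for each edge $(v,y)$ in the current $E'(v)$ choose an arbitrary disk $Del_v(v,y)$ and remove $(v,y)$ if $arc_i\subseteq\mathrm{int}(Del_v(v,y))$ and $vy$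 crosses $x'z'$ or $p'z'$. Let $PLDG(V)$ and $PLDG'(V)$ be the graphs with vertex set $V$ and edge sets $\bigcup_{v\in V}E(v)$ and $\bigcup_{v\in V}E'(v)$, where $E(v)$ and $E'(v)$ are the final edge sets. Then both algorithms can be executed on $V$ (all the required choices exist), and for every execution of PLDG and every execution of PLDG$'$ on $V$, whatever choices are made and in whatever order the sequences are listed and received: for each $v\in V$ and each edge $(v,y)$ of $LDT(v)$, PLDG$(v)$ removes $(v,y)$ from $E(v)$ if and only if PLDG$'(v)$ removes $(v,y)$ from $E'(v)$. Hence $PLDG'(V)=PLDG(V)$. -/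

import Mathlib

/-- The Euclidean plane. -/
abbrev Plane : Type := EuclideanSpace ℝ (Fin 2)

/-- General position: no three points of `V` are collinear and no four points of `V` are
cocircular. -/
def GeneralPosition (V : Finset Plane) : Prop :=
  (∀ T : Finset Plane, T ⊆ V → T.card = 3 → ¬ Collinear ℝ (T : Set Plane)) ∧
  (∀ T : Finset Plane, T ⊆ V → T.card = 4 → ¬ EuclideanGeometry.Cospherical (T : Set Plane))

/-- `N_v`: the points of `V` at distance at most one from `v` (including `v` itself). -/
noncomputable def nbhd (V : Finset Plane) (v : Plane) : Finset Plane :=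
  V.filter (fun u => dist u v ≤ 1)

/-- The circle `D` bounds a disk certifying that `(u, w)` is a Delaunay edge of `N`:
the points of `N` on the boundary are exactly `u` and `w`, and no point of `N` is in the
interior. -/
def IsDelaunayDisk (N : Finset Plane) (u w : Plane) (D : EuclideanGeometry.Sphere Plane) : Prop :=
  (N : Set Plane) ∩ Metric.sphere D.center D.radius = {u, w} ∧
  (N : Set Plane) ∩ Metric.ball D.center D.radius = ∅

/-- `(u, w)` is an edge of the Delaunay triangulation of `N`. -/
def IsDelaunayEdge (N : Finset Plane) (u w : Plane) : Prop :=
  u ≠ w ∧ ∃ D : EuclideanGeometry.Sphere Plane, IsDelaunayDisk N u w D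

/-- The circle `D` passes through all points of `T`. -/
def Circumscribes (D : EuclideanGeometry.Sphere Plane) (T : Finset Plane) : Prop :=
  (T : Set Plane) ⊆ Metric.sphere D.center D.radius

/-- `T` is the vertex set of a triangular face of the Delaunay triangulation of `N`. -/
def IsDelaunayFace (N : Finset Plane) (T : Finset Plane) : Prop :=
  T ⊆ N ∧ T.card = 3 ∧ ∃ D : EuclideanGeometry.Sphere Plane,
    Circumscribes D T ∧ (N : Set Plane) ∩ Metric.ball D.center D.radius = ∅

/-- `Δ_v`: the triangular faces `Δ(u, v, w)` of the Delaunay triangulation of `N` whose angle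
at `v` exceeds `π / 3`. -/
def wideFaces (N : Finset Plane) (v : Plane) : Set (Finset Plane) :=
  {T | IsDelaunayFace N T ∧ ∃ u w : Plane,
    (T : Set Plane) = {u, v, w} ∧ Real.pi / 3 < EuclideanGeometry.angle u v w}

/-- `cs = (c₁, …, c_k)` lists the circumcenters of the triangles in `Δ_v`, one for each
triangle, in some order. -/
def IsCenterList (N : Finset Plane) (v : Plane) (cs : List Plane) : Prop :=
  ∃ Ts : List (Finset Plane), Ts.Nodup ∧ (∀ T, T ∈ Ts ↔ T ∈ wideFaces N v) ∧
    List.Forall₂ (fun T c => ∃ r : ℝ, Circumscribes ⟨c, r⟩ T) Ts cs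

/-- The segments `ab` and `cd` cross: they are not collinear and their relative interiors
have a common point. -/
def Crosses (a b c d : Plane) : Prop :=
  ¬ Collinear ℝ ({a, b, c, d} : Set Plane) ∧ (openSegment ℝ a b ∩ openSegment ℝ c d).Nonempty

/-- The part of the circle with center `c` through `x` that is outside the closed unit disk
centered at `v`. -/
def outerArc (v c x : Plane) : Set Plane :=
  Metric.sphere c (dist c x) \ Metric.closedBall v 1

/-- The initial edge set at `v`: all Delaunay edges of `N` that are incident on `v`. -/
def initialEdges (N : Finset Plane) (v : Plane) : Set (Sym2 Plane) :=
  {e | ∃ y, e = s(v, y) ∧ IsDelaunayEdge N v y}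

/-- The inner loop over the edges `(v, y)` of `E`. The disks `Del y` are arbitrary
certificates, chosen separately for each edge. The edge `(v, y)` is removed if `arc` is in the
interior of `Del y` and `vy` crosses `az` or `bz`. The remaining edges form `E₁`. -/
def EdgeLoop (N : Finset Plane) (v a b z : Plane) (arc : Set Plane)
    (E E₁ : Set (Sym2 Plane)) : Prop :=
  ∃ Del : Plane → EuclideanGeometry.Sphere Plane,
    (∀ y, s(v, y) ∈ E → IsDelaunayDisk N v y (Del y)) ∧
    E₁ = {e ∈ E | ¬ ∃ y, e = s(v, y) ∧
      arc ⊆ Metric.ball (Del y).center (Del y).radius ∧ (Crosses v y a z ∨ Crosses v y b z)}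

/-- What the point `v`, knowing `N = N_v`, may do in algorithm PLDG with a center `c` received
from `x`: the edge set `E` becomes `E₁`. -/
def pldgCenterStep (N : Finset Plane) (v x c : Plane) (E E₁ : Set (Sym2 Plane)) : Prop :=
  (((N : Set Plane) ∩ Metric.sphere c (dist c x)).ncard = 2 →
    ∃ p z : Plane,
      p ∈ N ∧ p ≠ x ∧ p ∈ Metric.sphere c (dist c x) ∧
      z ∈ outerArc v c x ∧ (dist x z ≤ 1 ∨ dist p z ≤ 1) ∧
      EdgeLoop N v x p z (outerArc v c x) E E₁) ∧
  (((N : Set Plane) ∩ Metric.sphere c (dist c x)).ncard ≠ 2 → E₁ = E)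

/-- What the point `v`, knowing `N = N_v`, may do in the modified algorithm with a received
center `c` whose sender is unknown: it takes a point `x` of `N \ {v}` that is closest to `c`,
and the edge set `E` becomes `E₁`. -/
def anonCenterStep (N : Finset Plane) (v c : Plane) (E E₁ : Set (Sym2 Plane)) : Prop :=
  ∃ x : Plane, x ∈ N ∧ x ≠ v ∧ (∀ u ∈ N, u ≠ v → dist c x ≤ dist c u) ∧
  (((N : Set Plane) ∩ Metric.sphere c (dist c x)).ncard = 2 →
    ∃ p : Plane,
      p ∈ N ∧ p ≠ x ∧ p ∈ Metric.sphere c (dist c x) ∧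
      ((∃ z ∈ outerArc v c x, dist x z ≤ 1 ∨ dist p z ≤ 1) →
        ∃ z ∈ outerArc v c x, (dist x z ≤ 1 ∨ dist p z ≤ 1) ∧
          EdgeLoop N v x p z (outerArc v c x) E E₁) ∧
      ((¬ ∃ z ∈ outerArc v c x, dist x z ≤ 1 ∨ dist p z ≤ 1) → E₁ = E)) ∧
  (((N : Set Plane) ∩ Metric.sphere c (dist c x)).ncard ≠ 2 → E₁ = E)

/-- `Loop step l s t`: executing the (nondeterministic) loop body `step` for the elements of
`l`, in this order, can lead from state `s` to state `t`. -/
inductive Loop {α σ : Type} (step : α → σ → σ → Prop) : List α → σ → σ → Prop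
  | nil (s : σ) : Loop step [] s s
  | cons {a : α} {l : List α} {s t u : σ} :
      step a s t → Loop step l t u → Loop step (a :: l) s u

/-- `out` is the list of sequences (none or one) broadcast by a point `v` with `N = N_v`;
`mk cs` is the sequence that is sent when `cs` is the list of centers. -/
def Broadcasts {α : Type} (N : Finset Plane) (v : Plane) (mk : List Plane → α)
    (out : List α) : Prop :=
  (wideFaces N v = ∅ ∧ out = []) ∨
  ((wideFaces N v).Nonempty ∧ ∃ cs, IsCenterList N v cs ∧ out = [mk cs])

/-- An execution on `V` of a one-round algorithm: every `v` in `V` broadcasts `out v`, receives,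
in some order, the sequences broadcast by the points of `N_v`, and then runs its loop over
them, starting with the Delaunay edges of `N_v` at `v` and ending with the edge set `E v`. -/
def IsExecution {α : Type} (mk : Plane → List Plane → α)
    (step : Finset Plane → Plane → α → Set (Sym2 Plane) → Set (Sym2 Plane) → Prop)
    (V : Finset Plane) (E : Plane → Set (Sym2 Plane)) : Prop :=
  ∃ out inbox : Plane → List α, ∀ v ∈ V,
    Broadcasts (nbhd V v) v (mk v) (out v) ∧
    (inbox v).Perm ((nbhd V v).toList.flatMap out) ∧
    Loop (step (nbhd V v) v) (inbox v) (initialEdges (nbhd V v) v) (E v)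

/-- `E v`, for `v` in `V`, are the edge sets computed by an execution of algorithm PLDG, in
which `v` broadcasts its own location together with the centers. -/
def IsPLDGExecution (V : Finset Plane) (E : Plane → Set (Sym2 Plane)) : Prop :=
  IsExecution (α := Plane × List Plane) (fun v cs => (v, cs))
    (fun N v m => Loop (pldgCenterStep N v m.1) m.2) V E

/-- `E v`, for `v` in `V`, are the edge sets computed by an execution of the modified algorithm,
in which `v` broadcasts only the centers. -/
def IsAnonExecution (V : Finset Plane) (E : Plane → Set (Sym2 Plane)) : Prop :=
  IsExecution (α := List Plane) (fun _ cs => cs)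
    (fun N v cs => Loop (anonCenterStep N v) cs) V E

/-- The graph with vertex set `V` and edge set `⋃ v ∈ V, E v`. -/
def unionGraph (V : Finset Plane) (E : Plane → Set (Sym2 Plane)) : SimpleGraph V :=
  SimpleGraph.fromRel (fun a b => s((a : Plane), (b : Plane)) ∈ ⋃ v ∈ V, E v)

/-! Both algorithms react to a center `c` by deleting exactly `removedEdges N v c`, a set that
depends on `N = N_v`, `v` and `c`, but neither on the sender nor on any choice. Hence every
execution leaves `initialEdges` minus the union of these sets over all centers received
(`execution_of_step`), and the two results coincide.

Let `x` be the sender; its disk, with center `c` and `x` on the boundary, is empty for `N_x`. If `x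
= v`, the circle carries three points of `N_v` and the closest neighbors of `v` lie on it, so
nothing is removed. If the disk is empty for `N_v`, both algorithms test the same circle. By
`outerArc_independence` the chosen `z'` is irrelevant, and a crossing already forces the outer arc
into every Delaunay disk of the edge; this is why `removedEdges` mentions no such disk. If the disk
contains some `q` in `N_v`, then `|xq| > 1`, and neither algorithm removes anything:
`not_crosses_of_mem_ball` treats the circle of `x`, `not_crosses_of_concentric` the smaller one used
without the sender.

The geometry takes `v` as origin and rests on two facts. The difference of the powers with respect
to two circles is affine, so its signs on two crossing segments must agree at the crossing. And if
the chord on the line `vy` lies within the segment `vy`, the cap away from the center lies in the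
disk with diameter `vy`; as `|vy| ≤ 1`, points of this cap are at most one apart, against `|xq| >
1`. -/

/-! ### Plane vectors and powers of points. -/

/-- The dot product of two vectors of the plane. -/
def dot (P Q : Plane) : ℝ := P 0 * Q 0 + P 1 * Q 1

/-- The determinant of two vectors of the plane. -/
def det (P Q : Plane) : ℝ := P 0 * Q 1 - P 1 * Q 0

/-- The power of `P` with respect to the circle with center `c` for which the origin has
power `K`. -/
def pw (c : Plane) (K : ℝ) (P : Plane) : ℝ := dot P P - 2 * dot P c + K

lemma dot_self_nonneg (P : Plane) : 0 ≤ dot P P := by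
  unfold dot; nlinarith [sq_nonneg (P 0), sq_nonneg (P 1)]

lemma dot_self_pos {P : Plane} (h : P ≠ 0) : 0 < dot P P := by
  refine lt_of_le_of_ne (dot_self_nonneg P) fun h0 => h ?_
  unfold dot at h0
  have h1 : P 0 = 0 := by nlinarith [sq_nonneg (P 0), sq_nonneg (P 1)]
  have h2 : P 1 = 0 := by nlinarith [sq_nonneg (P 0), sq_nonneg (P 1)]
  ext i
  fin_cases i <;> simpa

lemma dot_comb (s t : ℝ) (P Q R : Plane) :
    dot (s • P + t • Q) R = s * dot P R + t * dot Q R := by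
  simp [dot]; ring

lemma dot_smul (s : ℝ) (P R : Plane) : dot (s • P) R = s * dot P R := by
  simp [dot]; ring

lemma dot_comm (P Q : Plane) : dot P Q = dot Q P := by
  unfold dot; ring

lemma dot_sub_self (P Q : Plane) :
    dot (P - Q) (P - Q) = dot P P - 2 * dot P Q + dot Q Q := by
  simp [dot]; ring

lemma det_comb (s t : ℝ) (y P Q : Plane) :
    det y (s • P + t • Q) = s * det y P + t * det y Q := by
  simp [det]; ring

lemma det_smul_self (s : ℝ) (y : Plane) : det y (s • y) = 0 := by
  simp [det]; ring

/-- Splits the inner product into components along and across `y`; the sign of the determinant term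
records whether `P` and `Q` are on the same side of the line. -/
lemma dot_mul_dot_self (y P Q : Plane) :
    dot y y * dot P Q = dot P y * dot Q y + det y P * det y Q := by
  simp only [dot, det]; ring

/-- The power is strictly convex, so a chord runs inside its disk. -/
lemma pw_comb (c : Plane) (K t : ℝ) (P Q : Plane) :
    pw c K ((1 - t) • P + t • Q) =
      (1 - t) * pw c K P + t * pw c K Q - t * (1 - t) * dot (P - Q) (P - Q) := by
  simp [pw, dot]; ring

lemma pw_smul (c : Plane) (K s : ℝ) (y : Plane) :
    pw c K (s • y) = s ^ 2 * dot y y - 2 * s * dot y c + K := by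
  simp [pw, dot]; ring

lemma eq_smul_of_det_eq_zero {y P : Plane} (hy : y ≠ 0) (h : det y P = 0) :
    P = (dot P y / dot y y) • y := by
  have hpos := dot_self_pos hy
  have h0 : P 0 * dot y y = dot P y * y 0 := by
    unfold det at h; unfold dot; linear_combination -y 1 * h
  have h1 : P 1 * dot y y = dot P y * y 1 := by
    unfold det at h; unfold dot; linear_combination y 0 * h
  ext i
  fin_cases i
  · simp; field_simp; exact h0
  · simp; field_simp; exact h1

/-- A segment whose end points are not on the same side of a line through the origin meets
this line. -/
lemma exists_comb_eq_smul {y P Q : Plane} (hy : y ≠ 0) (h : det y P * det y Q ≤ 0)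
    (hQ : det y Q ≠ 0) :
    ∃ t s : ℝ, 0 ≤ t ∧ t < 1 ∧ (det y P ≠ 0 → 0 < t) ∧
      (1 - t) • P + t • Q = s • y := by
  have hne : det y P - det y Q ≠ 0 := by
    intro h0
    have : det y P = det y Q := by linarith
    rw [this] at h
    exact absurd h (not_le.mpr (mul_self_pos.mpr hQ))
  have key : 0 < (det y P - det y Q) ^ 2 := by positivity
  have ht : det y P / (det y P - det y Q) =
      (det y P * (det y P - det y Q)) / (det y P - det y Q) ^ 2 := by
    field_simp
  refine ⟨det y P / (det y P - det y Q), _, ?_, ?_, fun hP => ?_,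
    eq_smul_of_det_eq_zero hy ?_⟩
  · rw [ht]; apply div_nonneg _ key.le; nlinarith [sq_nonneg (det y P)]
  · rw [ht, div_lt_one key]
    have : 0 < det y Q ^ 2 := by positivity
    nlinarith
  · rw [ht]; apply div_pos _ key
    have : 0 < det y P ^ 2 := by positivity
    nlinarith
  · rw [det_comb]; field_simp; ring

/-- If a chord on the line through `0` and `y` meets the segment from `0` to `y`, but `0` and
`y` are not interior points of the disk, then the chord is in this segment. -/
lemma mem_Icc_of_pw_smul_nonpos {c y : Plane} {K t s : ℝ} (hK : 0 ≤ K) (hy : 0 ≤ pw c K y)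
    (ht0 : 0 < t) (ht1 : t < 1) (ht : pw c K (t • y) < 0) (hs : pw c K (s • y) ≤ 0) :
    0 ≤ s ∧ s ≤ 1 := by
  rw [pw_smul] at ht hs
  unfold pw at hy
  have hA := dot_self_nonneg y
  constructor
  -- Along the line the power is a convex quadratic. It is nonpositive at `s` and negative at `t`,
  -- so with `s < 0 < t` it would be negative at `0`, where it is `K`. The other bound is symmetric.
  · by_contra! h
    have h1 : 0 ≤ dot y y * ((t - s) * (-s) * t) :=
      mul_nonneg hA (mul_nonneg (mul_nonneg (by linarith) (by linarith)) ht0.le)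
    nlinarith [mul_nonneg (show 0 ≤ t - s by linarith) hK,
      mul_pos (show 0 < -s by linarith) (neg_pos.mpr ht),
      mul_nonneg ht0.le (neg_nonneg.mpr hs)]
  · by_contra! h
    have h1 : 0 ≤ dot y y * ((s - 1) * (1 - t) * (s - t)) :=
      mul_nonneg hA (mul_nonneg (mul_nonneg (by linarith) (by linarith)) (by linarith))
    nlinarith [mul_nonneg (show 0 ≤ s - t by linarith) hy,
      mul_pos (show 0 < s - 1 by linarith) (neg_pos.mpr ht),
      mul_nonneg (show 0 ≤ 1 - t by linarith) (neg_nonneg.mpr hs)]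

lemma mem_Ioo_of_pw_smul_neg {c y : Plane} {K t s : ℝ} (hK : 0 ≤ K) (hy : 0 ≤ pw c K y)
    (ht0 : 0 < t) (ht1 : t < 1) (ht : pw c K (t • y) < 0) (hs : pw c K (s • y) < 0) :
    0 < s ∧ s < 1 := by
  obtain ⟨h0, h1⟩ := mem_Icc_of_pw_smul_nonpos hK hy ht0 ht1 ht hs.le
  refine ⟨lt_of_le_of_ne h0 fun h => ?_, lt_of_le_of_ne h1 fun h => ?_⟩
  · rw [← h, pw_smul] at hs
    have : K < 0 := by simpa using hs
    linarith
  · subst h; rw [one_smul] at hs; linarith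

/-- For a point of the disk, twice `dot P c` is at least `|P|² + K`. -/
lemma dot_center_pos {c P : Plane} {K : ℝ} (hK : 0 ≤ K) (hP : P ≠ 0) (h : pw c K P ≤ 0) :
    0 < dot P c := by
  have := dot_self_pos hP
  unfold pw at h; linarith

/-! ### Chords that cross the segment from the origin to `y`. -/

/-- The coordinates of a crossing of the segment from `0` to `y` and the segment from `a`
to `z`. -/
def CrossAt (y a z : Plane) (t u : ℝ) : Prop :=
  (0 < t ∧ t < 1) ∧ (0 < u ∧ u < 1) ∧ t • y = (1 - u) • a + u • z ∧
    det y a * det y z < 0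

lemma CrossAt.ne_zero {y a z : Plane} {t u : ℝ} (h : CrossAt y a z t u) : y ≠ 0 := by
  rintro rfl
  have := h.2.2.2
  simp [det] at this

lemma CrossAt.pw_neg {c y a z : Plane} {K t u : ℝ} (h : CrossAt y a z t u)
    (ha : pw c K a = 0) (hz : pw c K z = 0) : pw c K (t • y) < 0 := by
  obtain ⟨-, ⟨hu0, hu1⟩, he, hd⟩ := h
  rw [he, pw_comb, ha, hz]
  have hne : a - z ≠ 0 := by
    intro h0
    rw [sub_eq_zero.mp h0] at hd
    nlinarith [mul_self_nonneg (det y z)]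
  have := mul_pos (mul_pos hu0 (sub_pos.mpr hu1)) (dot_self_pos hne)
  linarith

/-- If a point `z` of a circle is connected to another point `a` of the circle by a chord that
crosses the segment from `0` to `y`, then `z` is inside of each circle through `0` and `y` that
does not surround `a`. -/
lemma CrossAt.pw_end_neg {c o y a z : Plane} {K t u : ℝ} (h : CrossAt y a z t u)
    (hK : 0 ≤ K) (hy : 0 ≤ pw c K y) (hKy : 0 < K ∨ 0 < pw c K y)
    (ha : pw c K a = 0) (hz : pw c K z = 0) (hoy : pw o 0 y = 0) (hoa : 0 ≤ pw o 0 a) :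
    pw o 0 z < 0 := by
  obtain ⟨⟨ht0, ht1⟩, ⟨hu0, hu1⟩, he, -⟩ := h
  have e1 := congrArg (dot · c) he
  have e2 := congrArg (dot · o) he
  simp only [dot_comb, dot_smul] at e1 e2
  -- The affine function `pw c K - pw o 0`, evaluated at the crossing along the segment from `0` to
  -- `y`, is positive. Along the chord it is a mean of `-pw o 0 a` and `-pw o 0 z`, and the former
  -- is not positive.
  have hL : 0 < (1 - t) * K + t * pw c K y := by
    rcases hKy with h | h
    · have := mul_pos (sub_pos.mpr ht1) h
      have := mul_nonneg ht0.le hy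
      linarith
    · have := mul_nonneg (sub_nonneg.mpr ht1.le) hK
      have := mul_pos ht0 h
      linarith
  have key : u * pw o 0 z = -((1 - t) * K + t * pw c K y) - (1 - u) * pw o 0 a := by
    unfold pw at *
    linear_combination t * hoy + (1 - u) * ha + u * hz - 2 * e1 + 2 * e2
  have := mul_nonneg (sub_nonneg.mpr hu1.le) hoa
  by_contra! hcon
  have := mul_nonneg hu0.le hcon
  linarith

/-- Whether a chord from `a` crosses the segment from `0` to `y` does not depend on its other
end point `z`, as long as this is a point of the circle outside of the unit disk. -/
lemma CrossAt.exists_of_outer {c y a z z' : Plane} {K t u : ℝ} (h : CrossAt y a z t u)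
    (hK : 0 ≤ K) (hy : 0 ≤ pw c K y) (hy1 : dot y y ≤ 1) (ha : pw c K a = 0)
    (hz : pw c K z = 0) (hz1 : 1 < dot z z) (hz' : pw c K z' = 0) (hz1' : 1 < dot z' z') :
    ∃ t' u', CrossAt y a z' t' u' := by
  have hy0 := h.ne_zero
  have hneg := h.pw_neg ha hz
  obtain ⟨⟨ht0, ht1⟩, ⟨hu0, hu1⟩, he, hd⟩ := h
  -- The line `2 * dot P c = 1 + K`, the radical axis of the circle and the unit circle, has the
  -- outer arc strictly on one side and `0` and `y` on the other (weakly). So the segment from `z'`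
  -- to `z` cannot meet the one from `0` to `y`.
  have hside : 0 < det y z' * det y z := by
    by_contra! hcon
    have hdz : det y z ≠ 0 := by rintro h0; simp [h0] at hd
    obtain ⟨w, s, hw0, hw1, -, hw⟩ := exists_comb_eq_smul hy0 hcon hdz
    have hp : pw c K (s • y) ≤ 0 := by
      rw [← hw, pw_comb, hz, hz']
      have := mul_nonneg (mul_nonneg hw0 (sub_nonneg.mpr hw1.le)) (dot_self_nonneg (z' - z))
      linarith
    obtain ⟨hs0, hs1⟩ := mem_Icc_of_pw_smul_nonpos hK hy ht0 ht1 hneg hp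
    have e := congrArg (dot · c) hw
    simp only [dot_comb, dot_smul] at e
    unfold pw at hy hz hz'
    have i1 : 0 < (1 - w) * (2 * dot z' c - (1 + K)) :=
      mul_pos (by linarith) (by linarith)
    have i2 : 0 ≤ w * (2 * dot z c - (1 + K)) := mul_nonneg hw0 (by linarith)
    have i3 : 0 ≤ s * ((1 + K) - 2 * dot y c) := mul_nonneg hs0 (by linarith)
    have i4 : 0 ≤ (1 - s) * (1 + K) := mul_nonneg (by linarith) (by linarith)
    linarith
  have hd' : det y a * det y z' < 0 := by
    have hzz : 0 < det y z ^ 2 := by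
      have : det y z ≠ 0 := by rintro h0; simp [h0] at hd
      positivity
    by_contra! hcon
    nlinarith [mul_nonneg hcon hside.le, mul_pos (neg_pos.mpr hd) hside,
      mul_nonneg (mul_nonneg hcon hside.le) hzz.le,
      mul_pos (mul_pos (neg_pos.mpr hd) hside) hzz]
  have hdz' : det y z' ≠ 0 := by rintro h0; simp [h0] at hd'
  have hda : det y a ≠ 0 := by rintro h0; simp [h0] at hd'
  obtain ⟨w, s, -, hw1, hw0, hw⟩ := exists_comb_eq_smul hy0 hd'.le hdz'
  have hX : CrossAt y a z' s w → ∃ t' u', CrossAt y a z' t' u' := fun h => ⟨_, _, h⟩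
  refine hX ⟨?_, ⟨hw0 hda, hw1⟩, hw.symm, hd'⟩
  refine mem_Ioo_of_pw_smul_neg hK hy ht0 ht1 hneg ?_
  rw [← hw, pw_comb, ha, hz']
  have hne : a - z' ≠ 0 := by
    intro h0
    rw [sub_eq_zero.mp h0] at hd'
    nlinarith [mul_self_nonneg (det y z')]
  have := mul_pos (mul_pos (hw0 hda) (sub_pos.mpr hw1)) (dot_self_pos hne)
  linarith

/-! ### Caps cut off by an edge. -/

/-- The foot `s • y` of the perpendicular from `P`. -/
lemma pw_foot {c y P : Plane} {K : ℝ} (hy : y ≠ 0) :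
    dot y y * pw c K ((dot P y / dot y y) • y) =
      dot y y * pw c K P - det y P ^ 2 + 2 * (det y P * det y c) := by
  have hpos := dot_self_pos hy
  rw [pw_smul]
  have h1 := dot_mul_dot_self y P P
  have h2 := dot_mul_dot_self y P c
  rw [dot_comm c y] at h2
  unfold pw
  field_simp
  linear_combination -h1 + 2 * h2

/-- The center of the circle is on the side of the outer arc. -/
lemma CrossAt.det_center_nonneg {c y a z : Plane} {K t u : ℝ} (h : CrossAt y a z t u)
    (hK : 0 ≤ K) (hy : 0 ≤ pw c K y) (hy1 : dot y y ≤ 1) (ha : pw c K a = 0)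
    (hz : pw c K z = 0) (hz1 : 1 < dot z z) : 0 ≤ det y z * det y c := by
  have hy0 := h.ne_zero
  have hneg := h.pw_neg ha hz
  obtain ⟨⟨ht0, ht1⟩, -, -, -⟩ := h
  have hpos := dot_self_pos hy0
  by_contra! hcon
  have hf := pw_foot (c := c) (P := z) (K := K) hy0
  -- If the center were across the line, the foot of `z` would be inside the disk, hence on the
  -- edge. Then `1 + K < 2 * dot z c < 2 * s * dot y c ≤ 1 + K`, a contradiction.
  have hs : pw c K ((dot z y / dot y y) • y) < 0 := by
    by_contra! h0
    nlinarith [mul_nonneg hpos.le h0, sq_nonneg (det y z)]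
  obtain ⟨hs0, hs1⟩ := mem_Ioo_of_pw_smul_neg hK hy ht0 ht1 hneg hs
  have h2 := dot_mul_dot_self y z c
  have hzy : dot z y = (dot z y / dot y y) * dot y y := by field_simp
  set s := dot z y / dot y y
  rw [hzy, dot_comm c y] at h2
  have h3 : dot z c < s * dot y c := by
    by_contra! h0
    nlinarith [mul_nonneg hpos.le (sub_nonneg.mpr h0)]
  unfold pw at hy hz
  nlinarith [mul_nonneg hs0.le (show 0 ≤ 1 + K - 2 * dot y c by linarith)]

/-- The smaller cap of a disk, cut off by a chord on the segment from `0` to `y`, is in the disk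
with this segment as diameter. -/
lemma dot_self_le_of_mem_cap {c y P : Plane} {K t : ℝ} (hy0 : y ≠ 0) (hK : 0 ≤ K)
    (hy : 0 ≤ pw c K y) (ht0 : 0 < t) (ht1 : t < 1) (ht : pw c K (t • y) < 0)
    (hP : pw c K P ≤ 0) (hs : det y P * det y c ≤ 0) : dot P P ≤ dot P y := by
  have hpos := dot_self_pos hy0
  have hf := pw_foot (c := c) (P := P) (K := K) hy0
  have hfs : pw c K ((dot P y / dot y y) • y) ≤ 0 := by
    by_contra! h0
    nlinarith [mul_pos hpos h0, sq_nonneg (det y P), mul_nonneg hpos.le (neg_nonneg.mpr hP)]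
  obtain ⟨hs0, hs1⟩ := mem_Icc_of_pw_smul_nonpos hK hy ht0 ht1 ht hfs
  have h2 := dot_mul_dot_self y P c
  have hPy : dot P y = (dot P y / dot y y) * dot y y := by field_simp
  set s := dot P y / dot y y
  rw [hPy, dot_comm c y] at h2
  have h3 : dot P c ≤ s * dot y c := by
    by_contra! h0
    nlinarith [mul_pos hpos (sub_pos.mpr h0)]
  unfold pw at hy hP
  rw [hPy]
  nlinarith [mul_nonneg hs0 (show 0 ≤ dot y y + K - 2 * dot y c by linarith),
    mul_nonneg (sub_nonneg.mpr hs1) hK]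

/-- Both hypotheses place a point in the disk with diameter from `0` to `y`, and no two points of a
disk are farther apart than its diameter. -/
lemma dot_sub_self_le {y P Q : Plane} (hP : dot P P ≤ dot P y) (hQ : dot Q Q ≤ dot Q y) :
    dot (P - Q) (P - Q) ≤ dot y y := by
  have : 0 ≤ dot (P + Q - y) (P + Q - y) := dot_self_nonneg _
  have e : dot (P + Q - y) (P + Q - y) + dot (P - Q) (P - Q) =
      2 * (dot P P - dot P y) + 2 * (dot Q Q - dot Q y) + dot y y := by
    simp [dot]; ring
  linarith

/-- Two points of a disk that are not inside of a circle through `0` and `y` are not separated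
by the segment from `0` to `y`, if this contains the chord on its line. -/
lemma det_mul_det_pos {c o y P Q : Plane} {K t : ℝ} (hy0 : y ≠ 0) (hK : 0 ≤ K)
    (hy : 0 ≤ pw c K y) (ht0 : 0 < t) (ht1 : t < 1) (ht : pw c K (t • y) < 0)
    (hP : pw c K P < 0) (hQ : pw c K Q ≤ 0) (hoy : pw o 0 y = 0) (hoP : 0 ≤ pw o 0 P)
    (hoQ : 0 ≤ pw o 0 Q) (hdQ : det y Q ≠ 0) : 0 < det y P * det y Q := by
  by_contra! hcon
  obtain ⟨w, s, hw0, hw1, -, hw⟩ := exists_comb_eq_smul hy0 hcon hdQ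
  have hp : pw c K (s • y) ≤ 0 := by
    rw [← hw, pw_comb]
    have := mul_nonneg (mul_nonneg hw0 (sub_nonneg.mpr hw1.le)) (dot_self_nonneg (P - Q))
    have := mul_nonneg (sub_nonneg.mpr hw1.le) (neg_nonneg.mpr hP.le)
    have := mul_nonneg hw0 (neg_nonneg.mpr hQ)
    linarith
  obtain ⟨hs0, hs1⟩ := mem_Icc_of_pw_smul_nonpos hK hy ht0 ht1 ht hp
  have e1 := congrArg (dot · c) hw
  have e2 := congrArg (dot · o) hw
  simp only [dot_comb, dot_smul] at e1 e2
  -- The difference of powers again: negative on the side of `P` and `Q`, nonnegative on the segment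
  -- from `0` to `y`.
  have key : (1 - w) * (pw c K P - pw o 0 P) + w * (pw c K Q - pw o 0 Q) =
      (1 - s) * K + s * (pw c K y - pw o 0 y) := by
    unfold pw
    linear_combination -2 * e1 + 2 * e2
  rw [hoy] at key
  have i1 : (1 - w) * (pw c K P - pw o 0 P) < 0 :=
    mul_neg_of_pos_of_neg (by linarith) (by linarith)
  have i2 : w * (pw c K Q - pw o 0 Q) ≤ 0 :=
    mul_nonpos_of_nonneg_of_nonpos hw0 (by linarith)
  have i3 := mul_nonneg (sub_nonneg.mpr hs1) hK
  have i4 := mul_nonneg hs0 hy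
  linarith

/-- Signs as sides of a line: `a` is opposite to `z`, the center is with `z`, and `q` is with `a`.
-/
lemma mul_nonpos_of_opposite {a z q c : ℝ} (haz : a * z < 0) (hzc : 0 ≤ z * c)
    (hqa : 0 < q * a) : q * c ≤ 0 := by
  have h1 : 0 < -(a * z) * (q * a) := mul_pos (by linarith) hqa
  by_contra! hcon
  have h2 : 0 ≤ (z * c) * (q * a) * (q * a) := mul_nonneg (mul_nonneg hzc hqa.le) hqa.le
  have h3 := mul_pos h1 hcon
  have ha : 0 < a ^ 2 := by
    have : a ≠ 0 := by rintro rfl; simp at haz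
    positivity
  nlinarith

/-- A disk `D` through `x` with an interior point `q` at distance more than one from `x`: no
admissible edge from `0` to `y`, with `y` not inside of `D`, separates `q` from the center. -/
lemma dot_sub_self_le_of_separated {c o y x q : Plane} {K t : ℝ} (hy0 : y ≠ 0) (hK : 0 ≤ K)
    (hy : 0 ≤ pw c K y) (ht0 : 0 < t) (ht1 : t < 1) (ht : pw c K (t • y) < 0)
    (hx : pw c K x = 0) (hq : pw c K q < 0) (hoy : pw o 0 y = 0) (hox : 0 ≤ pw o 0 x)
    (hoq : 0 ≤ pw o 0 q) (hdq : det y q ≠ 0) (hqc : det y q * det y c ≤ 0) :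
    dot (x - q) (x - q) ≤ dot y y := by
  refine dot_sub_self_le (dot_self_le_of_mem_cap hy0 hK hy ht0 ht1 ht hx.le ?_)
    (dot_self_le_of_mem_cap hy0 hK hy ht0 ht1 ht hq.le hqc)
  by_cases hdx : det y x = 0
  · simp [hdx]
  have hpos := det_mul_det_pos hy0 hK hy ht0 ht1 ht hq hx.le hoy hoq hox hdx
  by_contra! hcon
  have h2 : 0 < det y q ^ 2 := by positivity
  have h1 : 0 < det y x ^ 2 := by positivity
  have : (det y q * det y c) * (det y x * det y q) ≤ 0 :=
    mul_nonpos_of_nonpos_of_nonneg hqc (by linarith)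
  nlinarith [mul_pos hcon h2]

/-! ### Edges excluded by a far point in the disk. -/

/-- The case of an edge that ends outside of the disk: if the disk contains an admissible point
`q` far from `x`, then no admissible edge crosses a chord. -/
lemma CrossAt.false_of_far_mem {c o y x a z q : Plane} {K t u : ℝ} (h : CrossAt y a z t u)
    (hK : 0 ≤ K) (hy : 0 ≤ pw c K y) (hy1 : dot y y ≤ 1) (hx : pw c K x = 0)
    (ha : pw c K a = 0) (hz : pw c K z = 0) (hz1 : 1 < dot z z) (hq : pw c K q < 0)
    (hoy : pw o 0 y = 0) (hox : 0 ≤ pw o 0 x) (hoa : 0 ≤ pw o 0 a) (hoq : 0 ≤ pw o 0 q)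
    (hxq : 1 < dot (x - q) (x - q)) : False := by
  have hy0 := h.ne_zero
  have hneg := h.pw_neg ha hz
  have hc := h.det_center_nonneg hK hy hy1 ha hz hz1
  obtain ⟨⟨ht0, ht1⟩, -, -, hd⟩ := h
  have hda : det y a ≠ 0 := by rintro h0; simp [h0] at hd
  have hpos := det_mul_det_pos hy0 hK hy ht0 ht1 hneg hq ha.le hoy hoq hoa hda
  have hdq : det y q ≠ 0 := by rintro h0; simp [h0] at hpos
  have h1 := dot_sub_self_le_of_separated hy0 hK hy ht0 ht1 hneg hx hq hoy hox hoq hdq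
    (mul_nonpos_of_opposite hd hc hpos)
  linarith

/-- The case of an edge that ends at an interior point `y` of the disk, with an admissible disk
around the far point `w`. -/
lemma false_of_far_end_mem {c o y x w : Plane} {K : ℝ} (hy0 : y ≠ 0) (hx0 : x ≠ 0)
    (hw0 : w ≠ 0) (hK : 0 ≤ K) (hy : pw c K y < 0) (hy1 : dot y y ≤ 1) (hx : pw c K x = 0)
    (hx1 : dot x x ≤ 1) (hw : pw c K w = 0) (hw1 : 1 < dot w w)
    (hxy : 1 < dot (x - y) (x - y)) (hxw : dot (x - w) (x - w) ≤ 1) (hoy : pw o 0 y = 0)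
    (hox : 0 ≤ pw o 0 x) (how : pw o 0 w < 0) (hd : det y w ≠ 0) : False := by
  have hyc := dot_center_pos hK hy0 hy.le
  have hxc := dot_center_pos hK hx0 hx.le
  have hwc := dot_center_pos hK hw0 hw.le
  have hxpos := dot_self_pos hx0
  have hypos := dot_self_pos hy0
  rw [dot_sub_self] at hxy hxw
  -- If the line through `0` and `y` separates `x` and `w`, it meets the segment `xw` at `s • y`.
  -- For `s ≤ 1` this contradicts that the bisector of `0` and `x` separates `x` and `w` from `0`
  -- and `y`. For `s > 1` convexity of the distance from `x` puts `s • y` more than one from `x`,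
  -- although it lies on `xw`.
  rcases le_or_gt (det y x * det y w) 0 with hs | hs
  · obtain ⟨τ, s, h0, h1, -, he⟩ := exists_comb_eq_smul hy0 hs hd
    have e1 := congrArg (dot · c) he
    have e2 := congrArg (dot · x) he
    simp only [dot_comb, dot_smul] at e1 e2
    have hs0 : 0 < s := by
      by_contra! hcon
      nlinarith [mul_pos (sub_pos.mpr h1) hxc, mul_nonneg h0 hwc.le,
        mul_nonneg (neg_nonneg.mpr hcon) hyc.le]
    rw [dot_comm x w] at hxw
    rw [dot_comm x y] at hxy
    rcases le_or_gt s 1 with hs1 | hs1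
    · nlinarith [mul_nonneg h0 (show 0 ≤ 2 * dot w x - dot x x by linarith),
        mul_pos hs0 (show 0 < dot x x - 2 * dot y x by linarith),
        mul_nonneg (sub_nonneg.mpr hs1) hxpos.le, mul_pos (sub_pos.mpr h1) hxpos]
    · have hh : dot ((1 - τ) • x + τ • w - x) ((1 - τ) • x + τ • w - x) =
          τ ^ 2 * (dot x x - 2 * dot w x + dot w w) := by
        simp [dot]; ring
      have hh2 : dot (s • y - x) (s • y - x) =
          s ^ 2 * dot y y - 2 * s * dot y x + dot x x := by
        simp [dot]; ring
      rw [he, hh2] at hh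
      have hτ : τ ^ 2 * (dot x x - 2 * dot w x + dot w w) ≤ 1 := by
        have : τ ^ 2 ≤ 1 := by nlinarith
        have := mul_nonneg (sq_nonneg τ) (sub_nonneg.mpr hxw)
        linarith
      nlinarith [mul_pos hs0 (sub_pos.mpr hxy),
        mul_nonneg (mul_nonneg hs0.le (sub_pos.mpr hs1).le) hypos.le,
        mul_nonneg (sub_pos.mpr hs1).le (sub_nonneg.mpr hx1)]
  · have hdx : det y x ≠ 0 := by rintro h0; simp [h0] at hs
    have hdx2 : 0 < det y x ^ 2 := by positivity
    obtain ⟨α, β, hα, he⟩ : ∃ α β : ℝ, 0 < α ∧ w = α • x + β • y := by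
      refine ⟨det y w / det y x, det w x / det y x, ?_, ?_⟩
      · have : det y w / det y x = det y x * det y w / det y x ^ 2 := by field_simp
        rw [this]; positivity
      · ext i
        fin_cases i <;> simp <;> field_simp <;> simp [det] <;> ring
    have e1 := congrArg (dot · c) he
    have e2 := congrArg (dot · o) he
    have e3 := congrArg (dot · x) he
    simp only [dot_comb] at e1 e2 e3
    unfold pw at *
    -- For `β ≥ 0`, comparing powers puts `w` in the triangle `0xy`, hence in the unit disk. For `β
    -- < 0`, `|w|² < 2 * dot w o < dot w x`, so `w` is in the disk with diameter from `0` to `x`,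
    -- again in the unit disk.
    rcases le_or_gt 0 β with hβ | hβ
    · have hsum : α + β < 1 := by
        by_contra! hcon
        have i1 : 0 ≤ α * (2 * dot x c - 2 * dot x o - K) := mul_nonneg hα.le (by linarith)
        have i2 : 0 ≤ β * (2 * dot y c - 2 * dot y o - K) := mul_nonneg hβ (by linarith)
        nlinarith [mul_nonneg (sub_nonneg.mpr hcon) hK]
      have hww : dot w w = α ^ 2 * dot x x + 2 * (α * β) * dot x y + β ^ 2 * dot y y := by
        rw [he]; simp [dot]; ring
      have hxy2 : 2 * dot x y ≤ 2 := by
        have := dot_self_nonneg (x - y)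
        rw [dot_sub_self] at this
        linarith
      nlinarith [mul_nonneg (mul_nonneg hα.le hβ) (sub_nonneg.mpr hxy2),
        mul_nonneg (sq_nonneg α) (sub_nonneg.mpr hx1),
        mul_nonneg (sq_nonneg β) (sub_nonneg.mpr hy1)]
    · have hw2 := dot_self_nonneg (w - x)
      rw [dot_sub_self] at hw2
      rw [dot_comm x y] at hxy
      have i1 : 0 ≤ α * (dot x x - 2 * dot x o) := mul_nonneg hα.le (by linarith)
      have i2 : 0 < (-β) * (2 * dot y o - dot y x) := mul_pos (by linarith) (by linarith)
      nlinarith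

/-- The modified algorithm does not remove any edge because of a circle that is concentric with
and smaller than the circle of the sender `x`. -/
lemma CrossAt.false_of_concentric {c o y x a z : Plane} {K K₀ t u : ℝ}
    (h : CrossAt y a z t u) (hK : 0 ≤ K) (hKK : K < K₀) (hx0 : x ≠ 0) (ha0 : a ≠ 0)
    (hx : pw c K x = 0) (ha : pw c K₀ a = 0) (hz : pw c K₀ z = 0) (hz1 : 1 < dot z z)
    (hy : 0 ≤ pw c K₀ y) (hy1 : dot y y ≤ 1) (hax : 1 < dot (x - a) (x - a))
    (hoy : pw o 0 y = 0) (hox : 0 ≤ pw o 0 x) (hoa : 0 ≤ pw o 0 a)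
    (hxy : 1 < dot (x - y) (x - y) ∨ 0 ≤ pw c K y) : False := by
  have hy0 := h.ne_zero
  have hK₀ : 0 ≤ K₀ := by linarith
  have hneg₀ := h.pw_neg ha hz
  have hc := h.det_center_nonneg hK₀ hy hy1 ha hz hz1
  obtain ⟨⟨ht0, ht1⟩, -, -, hd⟩ := h
  have hda : det y a ≠ 0 := by rintro h0; simp [h0] at hd
  have hypos := dot_self_pos hy0
  have hneg : pw c K (t • y) < 0 := by
    rw [pw_smul] at hneg₀ ⊢; linarith
  rcases hxy with hxy | hxy
  swap
  · have h1 := dot_sub_self_le_of_separated hy0 hK hxy ht0 ht1 hneg hx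
      (by unfold pw at ha ⊢; linarith) hoy hox hoa hda
      (mul_nonpos_of_opposite hd hc (mul_self_pos.mpr hda))
    linarith
  have hxpos := dot_self_pos hx0
  have hxc := dot_center_pos hK hx0 hx.le
  have hac := dot_center_pos hK₀ ha0 ha.le
  rw [dot_sub_self] at hxy
  rw [pw_smul] at hneg₀
  unfold pw at *
  -- The quadratic `s ↦ pw c K₀ (s • y)` has both roots in `[0, 1]`, so their mean `dot y c / |y|²`
  -- is strictly between 0 and 1 and their product `K₀ / |y|²` is below 1.
  have hcy0 : 0 < dot y c := by
    by_contra! h0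
    nlinarith [mul_nonneg (sq_nonneg t) hypos.le, mul_nonneg ht0.le (neg_nonneg.mpr h0)]
  have hKy : K₀ < dot y y := by
    by_contra! h0
    nlinarith [mul_nonneg ht0.le hy, mul_nonneg (sub_nonneg.mpr ht1.le)
      (show 0 ≤ K₀ - t * dot y y by nlinarith)]
  have hcy : dot y c < dot y y := by
    by_contra! h0
    nlinarith [mul_nonneg ht0.le hy]
  rcases le_or_gt 0 (det y a * det y x) with hs | hs
  · have hdx : det y x * det y c ≤ 0 := by
      have := mul_nonpos_of_opposite (a := det y a) hd hc (mul_self_pos.mpr hda)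
      have h2 := mul_self_pos.mpr hda
      by_contra! hcon
      nlinarith [mul_pos hcon h2, mul_nonneg hs (neg_nonneg.mpr this)]
    have e := dot_mul_dot_self y x c
    rw [dot_comm c y] at e
    have h1 : 0 < dot x y := by
      by_contra! h0
      nlinarith [mul_pos hypos hxc, mul_nonneg (neg_nonneg.mpr h0) hcy0.le]
    nlinarith [mul_pos h1 (sub_pos.mpr hcy), mul_pos hypos
      (show 0 < dot x c - dot x y by linarith)]
  · have hdx : det y x ≠ 0 := by rintro h0; simp [h0] at hs
    obtain ⟨τ, s, h0, h1, h0', he⟩ := exists_comb_eq_smul hy0 hs.le hdx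
    replace h0 := h0' hda
    have e1 := congrArg (dot · c) he
    have e2 := congrArg (dot · o) he
    have e3 := congrArg (dot · y) he
    simp only [dot_comb, dot_smul] at e1 e2 e3
    have hs0 : 0 < s := by
      by_contra! hcon
      nlinarith [mul_pos (sub_pos.mpr h1) hac, mul_pos h0 hxc,
        mul_nonneg (neg_nonneg.mpr hcon) hcy0.le]
    -- The linear function `2 * dot P (c - o)` is nonnegative at `x`, at least `K₀` at `a` and at
    -- most `K₀` at `y`; it is compared at the common point `s • y`.
    have hsτ : 1 - τ ≤ s := by
      have i1 : 0 ≤ τ * (2 * dot x c - 2 * dot x o) := mul_nonneg h0.le (by linarith)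
      have i2 : 0 ≤ (1 - τ) * (2 * dot a c - 2 * dot a o - K₀) :=
        mul_nonneg (by linarith) (by linarith)
      have i3 : 0 ≤ s * (K₀ - 2 * dot y c + 2 * dot y o) := mul_nonneg hs0.le (by linarith)
      have i4 : 0 ≤ (s - (1 - τ)) * K₀ := by linarith
      exact sub_nonneg.mp (nonneg_of_mul_nonneg_left i4 (by linarith))
    have hay := dot_self_nonneg (a - y)
    rw [dot_sub_self] at hay
    -- The same comparison with `2 * dot P (c - y)`: the four terms sum to zero, but the first is
    -- positive because `|x - y| > 1`.
    have i1 : 0 < τ * (2 * dot x c - 2 * dot x y) := mul_pos h0 (by linarith)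
    have i2 : 0 ≤ (1 - τ) * (2 * dot a c - 2 * dot a y - K₀ + dot y y) :=
      mul_nonneg (by linarith) (by linarith)
    have i3 : 0 ≤ s * (K₀ - dot y y - 2 * dot y c + 2 * dot y y) :=
      mul_nonneg hs0.le (by linarith)
    have i4 : 0 ≤ (s - (1 - τ)) * (dot y y - K₀) := mul_nonneg (by linarith) (by linarith)
    linarith

/-! ### From distances and crossings to coordinates. -/

lemma dist_sq_eq_dot (P Q : Plane) : dist P Q ^ 2 = dot (P - Q) (P - Q) := by
  rw [EuclideanSpace.dist_sq_eq, Fin.sum_univ_two, Real.dist_eq, Real.dist_eq, sq_abs, sq_abs]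
  simp [dot]; ring

lemma pw_sub (v c P : Plane) (R : ℝ) :
    pw (c - v) (dist v c ^ 2 - R ^ 2) (P - v) = dist P c ^ 2 - R ^ 2 := by
  rw [dist_sq_eq_dot, dist_sq_eq_dot]
  simp [pw, dot]; ring

lemma pw_sub_zero {v o : Plane} {R : ℝ} (hv : dist v o = R) (P : Plane) :
    pw (o - v) 0 (P - v) = dist P o ^ 2 - R ^ 2 := by
  rw [← pw_sub v o P R, hv, sub_self]

lemma collinear_iff_det {v y : Plane} (hy : v ≠ y) (s : Set Plane) :
    Collinear ℝ (insert v (insert y s)) ↔ ∀ p ∈ s, det (y - v) (p - v) = 0 := by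
  have hy' : y - v ≠ 0 := sub_ne_zero.mpr hy.symm
  constructor
  · intro h p hp
    obtain ⟨d, hd⟩ := (collinear_iff_of_mem (Set.mem_insert v _)).mp h
    obtain ⟨r, hr⟩ := hd y (by simp)
    obtain ⟨r', hr'⟩ := hd p (by simp [hp])
    rw [hr, hr']
    simp [det]; ring
  · intro h
    refine (collinear_iff_of_mem (Set.mem_insert v _)).mpr ⟨y - v, ?_⟩
    rintro p (rfl | rfl | hp)
    · exact ⟨0, by simp⟩
    · exact ⟨1, by simp⟩
    · exact ⟨_, by rw [vadd_eq_add, ← eq_smul_of_det_eq_zero hy' (h p hp), sub_add_cancel]⟩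

/-- At a common point a mean of the two determinants with positive weights vanishes. So they have
opposite signs or both vanish, and the latter means collinearity. -/
lemma crosses_iff {v y a z : Plane} (hy : v ≠ y) :
    Crosses v y a z ↔ ∃ t u, CrossAt (y - v) (a - v) (z - v) t u := by
  have hcol : Collinear ℝ ({v, y, a, z} : Set Plane) ↔
      det (y - v) (a - v) = 0 ∧ det (y - v) (z - v) = 0 := by
    rw [collinear_iff_det hy]; simp
  unfold Crosses CrossAt
  rw [hcol]
  constructor
  · rintro ⟨hn, g, hg, hg'⟩
    rw [openSegment_eq_image] at hg hg'
    obtain ⟨t, ht, rfl⟩ := hg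
    obtain ⟨u, hu, he⟩ := hg'
    have he' : t • (y - v) = (1 - u) • (a - v) + u • (z - v) := by
      have : (1 - u) • (a - v) + u • (z - v) = ((1 - u) • a + u • z) - v := by module
      rw [this]
      refine Eq.trans ?_ (congrArg (· - v) he.symm)
      module
    refine ⟨t, u, ht, hu, he', ?_⟩
    have hdet := congrArg (det (y - v)) he'
    rw [det_smul_self, det_comb] at hdet
    have hu1 := sub_pos.mpr hu.2
    have hu0 := hu.1
    by_contra! hcon
    have h1 : (1 - u) * det (y - v) (a - v) ^ 2 +
        u * (det (y - v) (a - v) * det (y - v) (z - v)) = 0 := by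
      linear_combination -det (y - v) (a - v) * hdet
    have h2 := mul_nonneg hu0.le hcon
    have h3 : det (y - v) (a - v) = 0 := by
      by_contra h0
      have : 0 < det (y - v) (a - v) ^ 2 := by positivity
      have := mul_pos hu1 this
      linarith
    refine hn ⟨h3, ?_⟩
    rw [h3, mul_zero, zero_add] at hdet
    simpa [hu0.ne'] using hdet.symm
  · rintro ⟨t, u, ht, hu, he, hd⟩
    refine ⟨fun h => by simp [h.1] at hd, v + t • (y - v), ?_, ?_⟩
    · rw [openSegment_eq_image]
      exact ⟨t, ht, by module⟩
    · rw [openSegment_eq_image]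
      refine ⟨u, hu, ?_⟩
      rw [he]; module

lemma not_crosses_left (v y z : Plane) : ¬ Crosses v y v z := by
  intro h
  by_cases hy : v = y
  · subst hy
    obtain ⟨hn, g, hg, hg'⟩ := h
    rw [openSegment_same, Set.mem_singleton_iff] at hg
    exact hn (by simpa using collinear_pair ℝ v z)
  · obtain ⟨t, u, -, -, -, hd⟩ := (crosses_iff hy).mp h
    simp [det] at hd

lemma not_crosses_right (v y z : Plane) : ¬ Crosses v y y z := by
  intro h
  by_cases hy : v = y
  · subst hy
    exact not_crosses_left _ _ _ h
  · obtain ⟨t, u, -, -, -, hd⟩ := (crosses_iff hy).mp h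
    have : det (y - v) (y - v) = 0 := by unfold det; ring
    simp [this] at hd

section Delaunay

variable {N : Finset Plane} {v y : Plane} {D : EuclideanGeometry.Sphere Plane}

lemma IsDelaunayDisk.mem_right (h : IsDelaunayDisk N v y D) : y ∈ N := by
  have : y ∈ (N : Set Plane) ∩ Metric.sphere D.center D.radius := by rw [h.1]; simp
  exact this.1

lemma IsDelaunayDisk.dist_left (h : IsDelaunayDisk N v y D) : dist v D.center = D.radius := by
  have : v ∈ (N : Set Plane) ∩ Metric.sphere D.center D.radius := by rw [h.1]; simp
  exact this.2

lemma IsDelaunayDisk.dist_right (h : IsDelaunayDisk N v y D) : dist y D.center = D.radius := by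
  have : y ∈ (N : Set Plane) ∩ Metric.sphere D.center D.radius := by rw [h.1]; simp
  exact this.2

lemma IsDelaunayDisk.radius_nonneg (h : IsDelaunayDisk N v y D) : 0 ≤ D.radius := by
  rw [← h.dist_left]; exact dist_nonneg

lemma IsDelaunayDisk.le_dist (h : IsDelaunayDisk N v y D) {p : Plane} (hp : p ∈ N) :
    D.radius ≤ dist p D.center := by
  by_contra! hcon
  have : p ∈ (N : Set Plane) ∩ Metric.ball D.center D.radius := ⟨hp, hcon⟩
  rw [h.2] at this
  exact this

lemma IsDelaunayDisk.pw_right (h : IsDelaunayDisk N v y D) :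
    pw (D.center - v) 0 (y - v) = 0 := by
  rw [pw_sub_zero h.dist_left, h.dist_right, sub_self]

lemma IsDelaunayDisk.pw_nonneg (h : IsDelaunayDisk N v y D) {p : Plane} (hp : p ∈ N) :
    0 ≤ pw (D.center - v) 0 (p - v) := by
  rw [pw_sub_zero h.dist_left]
  have := h.le_dist hp
  have := h.radius_nonneg
  nlinarith

lemma IsDelaunayDisk.mem_ball_iff (h : IsDelaunayDisk N v y D) (p : Plane) :
    p ∈ Metric.ball D.center D.radius ↔ pw (D.center - v) 0 (p - v) < 0 := by
  rw [pw_sub_zero h.dist_left, Metric.mem_ball, sub_neg,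
    sq_lt_sq₀ dist_nonneg h.radius_nonneg]

end Delaunay

lemma sq_sub_sq_nonneg {a b : ℝ} (hb : 0 ≤ b) (h : b ≤ a) : 0 ≤ a ^ 2 - b ^ 2 :=
  sub_nonneg.mpr (pow_le_pow_left₀ hb h 2)

lemma dot_sub_le_one {u v : Plane} (h : dist u v ≤ 1) : dot (u - v) (u - v) ≤ 1 := by
  rw [← dist_sq_eq_dot]
  exact pow_le_one₀ dist_nonneg h

lemma one_lt_dot_sub {u v : Plane} (h : 1 < dist u v) : 1 < dot (u - v) (u - v) := by
  rw [← dist_sq_eq_dot]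
  exact one_lt_pow₀ h two_ne_zero

lemma one_lt_dot_of_mem_outerArc {v c x z : Plane} (h : z ∈ outerArc v c x) :
    1 < dot (z - v) (z - v) := by
  have := h.2
  rw [Metric.mem_closedBall, not_le] at this
  exact one_lt_dot_sub this

lemma pw_sub_of_mem_sphere {v c x a : Plane} (h : a ∈ Metric.sphere c (dist c x)) :
    pw (c - v) (dist v c ^ 2 - dist c x ^ 2) (a - v) = 0 := by
  rw [pw_sub, Metric.mem_sphere.mp h, sub_self]

/-! ### Geometry of the removal test. -/

/-- In an empty disk with exactly two points on its boundary, the choices of an end point in the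
outer arc and of a Delaunay disk are irrelevant. -/
theorem outerArc_independence {N : Finset Plane} {v x c y a z : Plane}
    {D : EuclideanGeometry.Sphere Plane} (hN : ∀ u ∈ N, dist u v ≤ 1) (hv : v ∈ N)
    (hvy : v ≠ y) (hempty : ∀ u ∈ N, dist c x ≤ dist u c)
    (hcard : ((N : Set Plane) ∩ Metric.sphere c (dist c x)).ncard = 2)
    (hD : IsDelaunayDisk N v y D) (ha : a ∈ N) (hac : a ∈ Metric.sphere c (dist c x))
    (hz : z ∈ outerArc v c x) (hcross : Crosses v y a z) :
    (∀ z' ∈ outerArc v c x, Crosses v y a z') ∧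
      outerArc v c x ⊆ Metric.ball D.center D.radius := by
  have hyN := hD.mem_right
  have hK := sq_sub_sq_nonneg dist_nonneg (hempty v hv)
  have hy : 0 ≤ pw (c - v) (dist v c ^ 2 - dist c x ^ 2) (y - v) := by
    rw [pw_sub]; exact sq_sub_sq_nonneg dist_nonneg (hempty y hyN)
  -- If `v` and `y` were both on the circle, they would be its only two points of `N`. Then `a`
  -- would be an end of the edge, and a segment from there does not cross the edge.
  have hKy : 0 < dist v c ^ 2 - dist c x ^ 2 ∨
      0 < pw (c - v) (dist v c ^ 2 - dist c x ^ 2) (y - v) := by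
    by_contra! hcon
    rw [pw_sub] at hcon
    have h1 : dist v c = dist c x :=
      le_antisymm (abs_le_of_sq_le_sq' (by linarith [hcon.1]) dist_nonneg).2 (hempty v hv)
    have h2 : dist y c = dist c x :=
      le_antisymm (abs_le_of_sq_le_sq' (by linarith [hcon.2]) dist_nonneg).2 (hempty y hyN)
    have hsub : ({v, y} : Set Plane) ⊆ (N : Set Plane) ∩ Metric.sphere c (dist c x) := by
      rintro p (rfl | rfl)
      · exact ⟨hv, h1⟩
      · exact ⟨hyN, h2⟩
    have heq := Set.eq_of_subset_of_ncard_le hsub (by rw [hcard, Set.ncard_pair hvy])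
      (N.finite_toSet.inter_of_left _)
    have : a ∈ ({v, y} : Set Plane) := heq ▸ ⟨ha, hac⟩
    rcases this with rfl | rfl
    · exact not_crosses_left _ _ _ hcross
    · exact not_crosses_right _ _ _ hcross
  have hind : ∀ z' ∈ outerArc v c x, Crosses v y a z' := by
    intro z' hz'
    obtain ⟨t, u, h⟩ := (crosses_iff hvy).mp hcross
    exact (crosses_iff hvy).mpr (h.exists_of_outer hK hy (dot_sub_le_one (hN y hyN))
      (pw_sub_of_mem_sphere hac) (pw_sub_of_mem_sphere hz.1) (one_lt_dot_of_mem_outerArc hz)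
      (pw_sub_of_mem_sphere hz'.1) (one_lt_dot_of_mem_outerArc hz'))
  refine ⟨hind, fun z' hz' => ?_⟩
  obtain ⟨t, u, h⟩ := (crosses_iff hvy).mp (hind z' hz')
  exact (hD.mem_ball_iff z').mpr (h.pw_end_neg hK hy hKy (pw_sub_of_mem_sphere hac)
    (pw_sub_of_mem_sphere hz'.1) hD.pw_right (hD.pw_nonneg ha))

/-- If the disk of the sender `x` contains a point `q` known to `v`, then the circle of this disk
does not cause the removal of any edge at `v`. -/
theorem not_crosses_of_mem_ball {N : Finset Plane} {v x c y a z w q : Plane}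
    {D : EuclideanGeometry.Sphere Plane} (hN : ∀ u ∈ N, dist u v ≤ 1)
    (hvy : v ≠ y) (hx : x ∈ N) (hxv : x ≠ v) (hvc : dist c x ≤ dist v c)
    (hxN : ∀ u ∈ N, dist u c < dist c x → 1 < dist x u)
    (hw : w ∈ outerArc v c x) (hxw : dist x w ≤ 1)
    (hcol : ¬ Collinear ℝ ({v, y, w} : Set Plane))
    (hq : q ∈ N) (hqc : dist q c < dist c x)
    (hD : IsDelaunayDisk N v y D) (ha : a ∈ N) (hac : a ∈ Metric.sphere c (dist c x))
    (hz : z ∈ outerArc v c x) (harc : outerArc v c x ⊆ Metric.ball D.center D.radius) :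
    ¬ Crosses v y a z := by
  intro hcross
  obtain ⟨t, u, h⟩ := (crosses_iff hvy).mp hcross
  have hyN := hD.mem_right
  have hK := sq_sub_sq_nonneg dist_nonneg hvc
  have hxc : x ∈ Metric.sphere c (dist c x) := dist_comm x c
  have hlt : ∀ {p}, dist p c < dist c x →
      pw (c - v) (dist v c ^ 2 - dist c x ^ 2) (p - v) < 0 := by
    intro p hp
    rw [pw_sub, sub_neg, sq_lt_sq₀ dist_nonneg dist_nonneg]
    exact hp
  have hfar : ∀ {p}, p ∈ N → dist p c < dist c x →
      1 < dot ((x - v) - (p - v)) ((x - v) - (p - v)) := by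
    intro p hp hpc
    rw [sub_sub_sub_cancel_right]
    exact one_lt_dot_sub (hxN p hp hpc)
  -- If `y` is inside the disk, it is itself a far point, and the contradiction comes from `w`;
  -- otherwise it comes from `q`.
  rcases lt_or_ge (dist y c) (dist c x) with hyc | hyc
  · have hw1 := one_lt_dot_of_mem_outerArc hw
    refine false_of_far_end_mem (sub_ne_zero.mpr hvy.symm) (sub_ne_zero.mpr hxv) (w := w - v)
      ?_ hK (hlt hyc) (dot_sub_le_one (hN y hyN)) (pw_sub_of_mem_sphere hxc)
      (dot_sub_le_one (hN x hx)) (pw_sub_of_mem_sphere hw.1) hw1 (hfar hyN hyc) ?_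
      hD.pw_right (hD.pw_nonneg hx) ((hD.mem_ball_iff w).mp (harc hw)) ?_
    · intro h0
      rw [h0] at hw1
      simp [dot] at hw1
      linarith
    · rw [sub_sub_sub_cancel_right]
      exact dot_sub_le_one hxw
    · intro h0
      exact hcol ((collinear_iff_det hvy {w}).mpr (by simpa using h0))
  · refine h.false_of_far_mem hK ?_ (dot_sub_le_one (hN y hyN)) (pw_sub_of_mem_sphere hxc)
      (pw_sub_of_mem_sphere hac) (pw_sub_of_mem_sphere hz.1) (one_lt_dot_of_mem_outerArc hz)
      (hlt hqc) hD.pw_right (hD.pw_nonneg hx) (hD.pw_nonneg ha) (hD.pw_nonneg hq) (hfar hq hqc)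
    rw [pw_sub]; exact sq_sub_sq_nonneg dist_nonneg hyc

/-- If the disk of the sender `x` contains a point `q` known to `v`, and `q` is closest to the
center, then the smaller circle through `q` does not cause the removal of any edge at `v`. -/
theorem not_crosses_of_concentric {N : Finset Plane} {v x c y a z q : Plane}
    {D : EuclideanGeometry.Sphere Plane} (hN : ∀ u ∈ N, dist u v ≤ 1) (hv : v ∈ N)
    (hvy : v ≠ y) (hx : x ∈ N) (hxv : x ≠ v) (hvc : dist c x ≤ dist v c)
    (hxN : ∀ u ∈ N, dist u c < dist c x → 1 < dist x u)
    (hqc : dist c q < dist c x) (hempty : ∀ u ∈ N, dist c q ≤ dist u c)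
    (hD : IsDelaunayDisk N v y D) (ha : a ∈ N) (hac : a ∈ Metric.sphere c (dist c q))
    (hz : z ∈ outerArc v c q) : ¬ Crosses v y a z := by
  intro hcross
  obtain ⟨t, u, h⟩ := (crosses_iff hvy).mp hcross
  have hyN := hD.mem_right
  have hxc : x ∈ Metric.sphere c (dist c x) := dist_comm x c
  have hac' : dist a c < dist c x := by rw [Metric.mem_sphere.mp hac]; exact hqc
  refine h.false_of_concentric (sq_sub_sq_nonneg dist_nonneg hvc)
    (K₀ := dist v c ^ 2 - dist c q ^ 2)
    (sub_lt_sub_left (by rwa [sq_lt_sq₀ dist_nonneg dist_nonneg]) _)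
    (sub_ne_zero.mpr hxv) (sub_ne_zero.mpr ?_) (pw_sub_of_mem_sphere hxc)
    (pw_sub_of_mem_sphere hac) (pw_sub_of_mem_sphere hz.1) (one_lt_dot_of_mem_outerArc hz) ?_
    (dot_sub_le_one (hN y hyN)) ?_ hD.pw_right (hD.pw_nonneg hx) (hD.pw_nonneg ha) ?_
  · rintro rfl
    linarith
  · rw [pw_sub]; exact sq_sub_sq_nonneg dist_nonneg (hempty y hyN)
  · rw [sub_sub_sub_cancel_right]
    exact one_lt_dot_sub (hxN a ha hac')
  · rw [sub_sub_sub_cancel_right]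
    rcases lt_or_ge (dist y c) (dist c x) with hyc | hyc
    · exact Or.inl (one_lt_dot_sub (hxN y hyN hyc))
    · right
      rw [pw_sub]; exact sq_sub_sq_nonneg dist_nonneg hyc

/-! ### Removed edges and broadcast centers. -/

/-- The edges `(v, y)` that are removed because of the center `c`. -/
def removedEdges (N : Finset Plane) (v c : Plane) : Set (Sym2 Plane) :=
  {e | ∃ x ∈ N, x ≠ v ∧ (∀ u ∈ N, u ≠ v → dist c x ≤ dist c u) ∧
    ((N : Set Plane) ∩ Metric.sphere c (dist c x)).ncard = 2 ∧
    ∃ y a b z, e = s(v, y) ∧ a ∈ (N : Set Plane) ∩ Metric.sphere c (dist c x) ∧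
      b ∈ (N : Set Plane) ∩ Metric.sphere c (dist c x) ∧ z ∈ outerArc v c x ∧ dist b z ≤ 1 ∧
      Crosses v y a z}

/-- `c` is one of the circumcenters broadcast by `x`. -/
def IsSentCenter (V : Finset Plane) (x c : Plane) : Prop :=
  ∃ T ∈ wideFaces (nbhd V x) x, ∃ r : ℝ, Circumscribes ⟨c, r⟩ T

lemma eq_or_eq_of_ncard_eq_two {S : Set Plane} (h : S.ncard = 2) {x p a : Plane} (hx : x ∈ S)
    (hp : p ∈ S) (hpx : p ≠ x) (ha : a ∈ S) : a = x ∨ a = p := by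
  have hsub : ({x, p} : Set Plane) ⊆ S := by
    rintro q (rfl | rfl)
    · exact hx
    · exact hp
  have heq := Set.eq_of_subset_of_ncard_le hsub (by rw [h, Set.ncard_pair hpx.symm])
    (Set.finite_of_ncard_ne_zero (by rw [h]; exact two_ne_zero))
  rw [← heq] at ha
  exact ha

lemma exists_mem_sphere_ne {N : Finset Plane} {c x : Plane}
    (h : ((N : Set Plane) ∩ Metric.sphere c (dist c x)).ncard = 2) :
    ∃ p ∈ N, p ≠ x ∧ p ∈ Metric.sphere c (dist c x) := by
  obtain ⟨p, hp, hpx⟩ := Set.exists_ne_of_one_lt_ncard (by rw [h]; exact one_lt_two) x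
  exact ⟨p, hp.1, hpx, hp.2⟩

lemma mem_initialEdges {N : Finset Plane} {v y : Plane} :
    s(v, y) ∈ initialEdges N v ↔ IsDelaunayEdge N v y := by
  constructor
  · rintro ⟨y', he, h⟩
    rwa [Sym2.congr_right.mp he]
  · exact fun h => ⟨y, rfl, h⟩

/-- As `R` describes the test for every Delaunay disk of an edge, the disks chosen in the loop do
not matter. -/
lemma EdgeLoop.eq_diff {N : Finset Plane} {v a b z : Plane} {arc : Set Plane}
    {E E₁ R : Set (Sym2 Plane)} (h : EdgeLoop N v a b z arc E E₁)
    (hE : E ⊆ initialEdges N v)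
    (hR : ∀ y D, v ≠ y → IsDelaunayDisk N v y D → (s(v, y) ∈ R ↔
      arc ⊆ Metric.ball D.center D.radius ∧ (Crosses v y a z ∨ Crosses v y b z))) :
    E₁ = E \ R := by
  obtain ⟨Del, hDel, rfl⟩ := h
  ext e
  simp only [Set.mem_ofPred_eq, Set.mem_sdiff]
  refine and_congr_right fun he => not_congr ?_
  obtain ⟨y, rfl, hy⟩ := hE he
  rw [hR y (Del y) hy.1 (hDel y he)]
  constructor
  · rintro ⟨y', hy', h⟩
    rwa [Sym2.congr_right.mp hy']
  · exact fun h => ⟨y, rfl, h⟩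

lemma exists_edgeLoop {N : Finset Plane} {v : Plane} {E : Set (Sym2 Plane)}
    (hE : E ⊆ initialEdges N v) (a b z : Plane) (arc : Set Plane) :
    ∃ E₁, EdgeLoop N v a b z arc E E₁ := by
  have : ∀ y, ∃ D, s(v, y) ∈ E → IsDelaunayDisk N v y D := by
    intro y
    by_cases h : s(v, y) ∈ E
    · obtain ⟨D, hD⟩ := (mem_initialEdges.mp (hE h)).2
      exact ⟨D, fun _ => hD⟩
    · exact ⟨⟨v, 0⟩, fun h' => absurd h' h⟩
  choose Del hDel using this
  exact ⟨_, Del, hDel, rfl⟩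

/-- In a disk that is empty for `v`, the removal test gives the same result for all choices. -/
lemma mem_removedEdges_iff {N : Finset Plane} {v c x p z y : Plane}
    {D : EuclideanGeometry.Sphere Plane} (hN : ∀ u ∈ N, dist u v ≤ 1) (hv : v ∈ N)
    (hx : x ∈ N) (hxv : x ≠ v) (hempty : ∀ u ∈ N, dist c x ≤ dist u c)
    (hcard : ((N : Set Plane) ∩ Metric.sphere c (dist c x)).ncard = 2) (hp : p ∈ N)
    (hpx : p ≠ x) (hpc : p ∈ Metric.sphere c (dist c x)) (hz : z ∈ outerArc v c x)
    (hz1 : dist x z ≤ 1 ∨ dist p z ≤ 1) (hvy : v ≠ y) (hD : IsDelaunayDisk N v y D) :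
    s(v, y) ∈ removedEdges N v c ↔ outerArc v c x ⊆ Metric.ball D.center D.radius ∧
      (Crosses v y x z ∨ Crosses v y p z) := by
  have hxS : x ∈ (N : Set Plane) ∩ Metric.sphere c (dist c x) := ⟨hx, dist_comm x c⟩
  have hpS : p ∈ (N : Set Plane) ∩ Metric.sphere c (dist c x) := ⟨hp, hpc⟩
  constructor
  · rintro ⟨x', hx', hxv', hmin, -, y', a, b, z', he, ha, -, hz', -, hcross⟩
    rw [← Sym2.congr_right.mp he] at hcross
    have hdist : dist c x' = dist c x :=
      le_antisymm (hmin x hx hxv) (by rw [dist_comm c x']; exact hempty x' hx')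
    have harc : outerArc v c x' = outerArc v c x := by unfold outerArc; rw [hdist]
    rw [hdist] at ha
    rw [harc] at hz'
    obtain ⟨h1, h2⟩ := outerArc_independence hN hv hvy hempty hcard hD ha.1 ha.2 hz' hcross
    refine ⟨h2, ?_⟩
    rcases eq_or_eq_of_ncard_eq_two hcard hxS hpS hpx ha with rfl | rfl
    · exact Or.inl (h1 z hz)
    · exact Or.inr (h1 z hz)
  · rintro ⟨-, hcross⟩
    obtain ⟨a, ha, hcross⟩ : ∃ a ∈ (N : Set Plane) ∩ Metric.sphere c (dist c x),
        Crosses v y a z := by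
      rcases hcross with h | h
      · exact ⟨x, hxS, h⟩
      · exact ⟨p, hpS, h⟩
    obtain ⟨b, hb, hbz⟩ : ∃ b ∈ (N : Set Plane) ∩ Metric.sphere c (dist c x), dist b z ≤ 1 := by
      rcases hz1 with h | h
      · exact ⟨x, hxS, h⟩
      · exact ⟨p, hpS, h⟩
    exact ⟨x, hx, hxv, fun u hu _ => by rw [dist_comm c u]; exact hempty u hu, hcard, y, a, b, z,
      rfl, ha, hb, hz, hbz, hcross⟩

lemma mem_nbhd {V : Finset Plane} {u v : Plane} : u ∈ nbhd V v ↔ u ∈ V ∧ dist u v ≤ 1 := by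
  simp [nbhd]

lemma mem_nbhd_self {V : Finset Plane} {v : Plane} (hv : v ∈ V) : v ∈ nbhd V v := by
  simp [mem_nbhd, hv]

lemma GeneralPosition.not_collinear {V : Finset Plane} (hV : GeneralPosition V) {a b c : Plane}
    (ha : a ∈ V) (hb : b ∈ V) (hc : c ∈ V) (hab : a ≠ b) (hac : a ≠ c) (hbc : b ≠ c) :
    ¬ Collinear ℝ ({a, b, c} : Set Plane) := by
  have := hV.1 {a, b, c} (by intro p; simp; rintro (rfl | rfl | rfl) <;> assumption)
    (Finset.card_eq_three.mpr ⟨a, b, c, hab, hac, hbc, rfl⟩)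
  simpa using this

/-- Differences of the squared equations are linear in the center; Cramer's rule applies since the
determinant is nonzero. -/
lemma eq_of_dist_eq {a b p c c' : Plane} (h : ¬ Collinear ℝ ({a, b, p} : Set Plane))
    (hab : a ≠ b) (h1 : dist a c = dist b c) (h2 : dist a c = dist p c)
    (h1' : dist a c' = dist b c') (h2' : dist a c' = dist p c') : c = c' := by
  have hd : det (b - a) (p - a) ≠ 0 := fun h0 =>
    h ((collinear_iff_det hab {p}).mpr (by simpa using h0))
  have e1 := congrArg (· ^ 2) h1
  have e2 := congrArg (· ^ 2) h2
  have e1' := congrArg (· ^ 2) h1'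
  have e2' := congrArg (· ^ 2) h2'
  simp only [dist_sq_eq_dot, dot, PiLp.sub_apply] at e1 e2 e1' e2'
  simp only [det, PiLp.sub_apply] at hd
  ext i
  refine sub_eq_zero.mp ((mul_eq_zero.mp ?_).resolve_left hd)
  fin_cases i
  · change _ * (c 0 - c' 0) = 0
    linear_combination (p 1 - a 1) / 2 * (e1 - e1') - (b 1 - a 1) / 2 * (e2 - e2')
  · change _ * (c 1 - c' 1) = 0
    linear_combination (b 0 - a 0) / 2 * (e2 - e2') - (p 0 - a 0) / 2 * (e1 - e1')

lemma GeneralPosition.center_unique {V T : Finset Plane} (hV : GeneralPosition V) (hT : T ⊆ V)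
    (hcard : T.card = 3) {D D' : EuclideanGeometry.Sphere Plane} (h : Circumscribes D T)
    (h' : Circumscribes D' T) : D.center = D'.center := by
  obtain ⟨a, b, p, hab, hap, hbp, rfl⟩ := Finset.card_eq_three.mp hcard
  have ha : a ∈ ({a, b, p} : Finset Plane) := by simp
  have hb : b ∈ ({a, b, p} : Finset Plane) := by simp
  have hp : p ∈ ({a, b, p} : Finset Plane) := by simp
  exact eq_of_dist_eq (hV.not_collinear (hT ha) (hT hb) (hT hp) hab hap hbp) hab
    ((h ha).trans (h hb).symm) ((h ha).trans (h hp).symm)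
    ((h' ha).trans (h' hb).symm) ((h' ha).trans (h' hp).symm)

/-- The circle around a center sent by `x` passes through three points of `N_x`, one of them `x`,
and its interior contains no point of `N_x`. -/
lemma IsSentCenter.exists_face {V : Finset Plane} (hV : GeneralPosition V) {x c : Plane}
    (h : IsSentCenter V x c) :
    ∃ T : Finset Plane, T ⊆ nbhd V x ∧ T.card = 3 ∧ x ∈ T ∧
      (∀ u ∈ T, u ∈ Metric.sphere c (dist c x)) ∧ ∀ u ∈ nbhd V x, dist c x ≤ dist u c := by
  obtain ⟨T, ⟨⟨hTN, hT3, D, hD, hDe⟩, u, w, hTu, -⟩, r, hr⟩ := h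
  have hTV : T ⊆ V := fun p hp => (mem_nbhd.mp (hTN hp)).1
  have hc : c = D.center := hV.center_unique hTV hT3 hr hD
  have hxT : x ∈ (T : Set Plane) := by rw [hTu]; simp
  have hcx : dist c x = D.radius := by rw [hc, dist_comm]; exact hD hxT
  refine ⟨T, hTN, hT3, hxT, fun u hu => ?_, fun u hu => ?_⟩
  · rw [hcx, hc]; exact hD hu
  · by_contra! hcon
    have : u ∈ ((nbhd V x : Finset Plane) : Set Plane) ∩ Metric.ball D.center D.radius := by
      refine ⟨hu, ?_⟩
      rw [← hcx, ← hc]; exact hcon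
    rw [hDe] at this
    exact this

lemma ncard_ne_two {N T : Finset Plane} {S : Set Plane} (hT : T ⊆ N) (h3 : T.card = 3)
    (hS : ∀ u ∈ T, u ∈ S) : ((N : Set Plane) ∩ S).ncard ≠ 2 := by
  have hsub : (T : Set Plane) ⊆ (N : Set Plane) ∩ S := fun u hu => ⟨hT hu, hS u hu⟩
  have := Set.ncard_le_ncard hsub (N.finite_toSet.inter_of_left _)
  rw [Set.ncard_coe_finset, h3] at this
  omega

lemma IsSentCenter.ncard_self_ne_two {V : Finset Plane} (hV : GeneralPosition V) {v c : Plane}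
    (h : IsSentCenter V v c) :
    ((nbhd V v : Set Plane) ∩ Metric.sphere c (dist c v)).ncard ≠ 2 := by
  obtain ⟨T, hT, h3, -, hS, -⟩ := h.exists_face hV
  exact ncard_ne_two hT h3 hS

/-- If the circle of `x` contains only two points of `N_v`, its third point is in the outer
arc. -/
lemma IsSentCenter.exists_mem_outerArc {V : Finset Plane} (hV : GeneralPosition V)
    {v x c : Plane} (h : IsSentCenter V x c)
    (hcard : ((nbhd V v : Set Plane) ∩ Metric.sphere c (dist c x)).ncard = 2) :
    ∃ w ∈ V, w ∈ outerArc v c x ∧ dist x w ≤ 1 := by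
  obtain ⟨T, hT, h3, -, hS, -⟩ := h.exists_face hV
  have hTv : ¬ T ⊆ nbhd V v := fun hTv => ncard_ne_two hTv h3 hS hcard
  obtain ⟨w, hw, hwv⟩ := Finset.not_subset.mp hTv
  obtain ⟨hwV, hwx⟩ := mem_nbhd.mp (hT hw)
  refine ⟨w, hwV, ⟨hS w hw, fun hwb => hwv (mem_nbhd.mpr ⟨hwV, hwb⟩)⟩, ?_⟩
  rwa [dist_comm]

/-! ### The effect of a single center. -/

section Steps

variable {V : Finset Plane} {v x c : Plane} {E E₁ : Set (Sym2 Plane)}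

lemma IsSentCenter.le_dist (hV : GeneralPosition V) (h : IsSentCenter V x c) {u : Plane}
    (hu : u ∈ V) (hux : dist u x ≤ 1) : dist c x ≤ dist u c := by
  obtain ⟨T, -, -, -, -, he⟩ := h.exists_face hV
  exact he u (mem_nbhd.mpr ⟨hu, hux⟩)

lemma anonCenterStep_eq (hV : GeneralPosition V) (hv : v ∈ V) (hx : x ∈ nbhd V v)
    (hc : IsSentCenter V x c) (hE : E ⊆ initialEdges (nbhd V v) v)
    (h : anonCenterStep (nbhd V v) v c E E₁) : E₁ = E \ removedEdges (nbhd V v) v c := by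
  have hN : ∀ u ∈ nbhd V v, dist u v ≤ 1 := fun u hu => (mem_nbhd.mp hu).2
  obtain ⟨x', hx', hxv', hmin, h2, hn2⟩ := h
  -- The minimum omits `v`, so `v` needs an argument. If `v` is the sender, another vertex of its
  -- triangle is equally far from `c`; otherwise `x` competes in the minimum and its disk does not
  -- have `v` inside.
  have hvc : dist c x' ≤ dist v c := by
    rcases eq_or_ne x v with rfl | hxv
    · obtain ⟨T, hT, h3, hxT, hS, -⟩ := hc.exists_face hV
      obtain ⟨u, hu, hux⟩ := Finset.exists_mem_ne (s := T) (by omega) x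
      have h1 := hmin u (hT hu) hux
      rw [dist_comm c u, hS u hu] at h1
      rwa [dist_comm x c]
    · exact (hmin x hx hxv).trans
        (hc.le_dist hV hv (by rw [dist_comm]; exact hN x hx))
  have hempty : ∀ u ∈ nbhd V v, dist c x' ≤ dist u c := by
    intro u hu
    rcases eq_or_ne u v with rfl | huv
    · exact hvc
    · rw [dist_comm u c]; exact hmin u hu huv
  have hself : ∀ {y}, s(v, y) ∈ removedEdges (nbhd V v) v c →
      ((nbhd V v : Set Plane) ∩ Metric.sphere c (dist c x')).ncard = 2 ∧
      ∃ b ∈ (nbhd V v : Set Plane) ∩ Metric.sphere c (dist c x'), ∃ z ∈ outerArc v c x',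
        dist b z ≤ 1 := by
    rintro y ⟨x'', hx'', hxv'', hmin'', hcard, -, -, b, z, -, -, hb, hz, hbz, -⟩
    have hdist : dist c x'' = dist c x' :=
      le_antisymm (hmin'' x' hx' hxv') (hmin x'' hx'' hxv'')
    have harc : outerArc v c x'' = outerArc v c x' := by unfold outerArc; rw [hdist]
    rw [hdist] at hcard hb
    rw [harc] at hz
    exact ⟨hcard, b, hb, z, hz, hbz⟩
  have hdiff : (∀ {y}, s(v, y) ∉ removedEdges (nbhd V v) v c) →
      E = E \ removedEdges (nbhd V v) v c := by
    intro h0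
    refine (sdiff_eq_left.mpr (Set.disjoint_left.mpr fun e he => ?_)).symm
    obtain ⟨y, rfl, -⟩ := hE he
    exact h0
  by_cases hcard : ((nbhd V v : Set Plane) ∩ Metric.sphere c (dist c x')).ncard = 2
  · obtain ⟨p, hp, hpx, hpc, hZ, hnZ⟩ := h2 hcard
    by_cases hz : ∃ z ∈ outerArc v c x', dist x' z ≤ 1 ∨ dist p z ≤ 1
    · obtain ⟨z, hz, hz1, hloop⟩ := hZ hz
      exact hloop.eq_diff hE fun y D hvy hD => mem_removedEdges_iff hN (mem_nbhd_self hv) hx'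
        hxv' hempty hcard hp hpx hpc hz hz1 hvy hD
    · rw [hnZ hz]
      refine hdiff fun h0 => hz ?_
      obtain ⟨-, b, hb, z, hzo, hbz⟩ := hself h0
      rcases eq_or_eq_of_ncard_eq_two hcard ⟨hx', dist_comm x' c⟩ ⟨hp, hpc⟩ hpx hb
        with rfl | rfl
      · exact ⟨z, hzo, Or.inl hbz⟩
      · exact ⟨z, hzo, Or.inr hbz⟩
  · rw [hn2 hcard]
    exact hdiff fun h0 => hcard (hself h0).1

/-- A closest point other than `v` exists because the sender, or another vertex of the triangle if
`v` is the sender, is a candidate. An empty `Z` asks for no further choice. -/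
lemma exists_anonCenterStep (hV : GeneralPosition V) (hx : x ∈ nbhd V v)
    (hc : IsSentCenter V x c) (hE : E ⊆ initialEdges (nbhd V v) v) :
    ∃ E₁, anonCenterStep (nbhd V v) v c E E₁ := by
  have hne : ((nbhd V v).filter (· ≠ v)).Nonempty := by
    rcases eq_or_ne x v with rfl | hxv
    · obtain ⟨T, hT, h3, -, -, -⟩ := hc.exists_face hV
      obtain ⟨u, hu, hux⟩ := Finset.exists_mem_ne (s := T) (by omega) x
      exact ⟨u, by simp [hT hu, hux]⟩
    · exact ⟨x, by simp [hx, hxv]⟩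
  obtain ⟨x', hx', hmin⟩ := Finset.exists_min_image _ (dist c) hne
  simp only [Finset.mem_filter, and_imp] at hx' hmin
  by_cases hcard : ((nbhd V v : Set Plane) ∩ Metric.sphere c (dist c x')).ncard = 2
  · obtain ⟨p, hp, hpx, hpc⟩ := exists_mem_sphere_ne hcard
    by_cases hz : ∃ z ∈ outerArc v c x', dist x' z ≤ 1 ∨ dist p z ≤ 1
    · obtain ⟨z, hz', hz1⟩ := hz
      obtain ⟨E₁, hE₁⟩ := exists_edgeLoop hE x' p z (outerArc v c x')
      exact ⟨E₁, x', hx'.1, hx'.2, hmin, fun _ => ⟨p, hp, hpx, hpc,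
        fun _ => ⟨z, hz', hz1, hE₁⟩, fun h => absurd ⟨z, hz', hz1⟩ h⟩, fun h => absurd hcard h⟩
    · exact ⟨E, x', hx'.1, hx'.2, hmin, fun _ => ⟨p, hp, hpx, hpc,
        fun h => absurd h hz, fun _ => rfl⟩, fun h => absurd hcard h⟩
  · exact ⟨E, x', hx'.1, hx'.2, hmin, fun h => absurd h hcard, fun _ => rfl⟩

/-- The third vertex of the sender's triangle serves as `z'`. -/
lemma exists_pldgCenterStep (hV : GeneralPosition V)
    (hc : IsSentCenter V x c) (hE : E ⊆ initialEdges (nbhd V v) v) :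
    ∃ E₁, pldgCenterStep (nbhd V v) v x c E E₁ := by
  by_cases hcard : ((nbhd V v : Set Plane) ∩ Metric.sphere c (dist c x)).ncard = 2
  · obtain ⟨p, hp, hpx, hpc⟩ := exists_mem_sphere_ne hcard
    obtain ⟨w, -, hw, hxw⟩ := hc.exists_mem_outerArc hV hcard
    obtain ⟨E₁, hE₁⟩ := exists_edgeLoop hE x p w (outerArc v c x)
    exact ⟨E₁, fun _ => ⟨p, w, hp, hpx, hpc, hw, Or.inl hxw, hE₁⟩, fun h => absurd hcard h⟩
  · exact ⟨E, fun h => absurd h hcard, fun _ => rfl⟩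

/-- Three cases: `v` is the sender, the sender's disk is empty for `N_v`, or it has a point of `N_v`
inside. In the first and last case both the step and `removedEdges` leave `E` unchanged. -/
lemma pldgCenterStep_eq (hV : GeneralPosition V) (hv : v ∈ V) (hx : x ∈ nbhd V v)
    (hc : IsSentCenter V x c) (hE : E ⊆ initialEdges (nbhd V v) v)
    (h : pldgCenterStep (nbhd V v) v x c E E₁) : E₁ = E \ removedEdges (nbhd V v) v c := by
  have hN : ∀ u ∈ nbhd V v, dist u v ≤ 1 := fun u hu => (mem_nbhd.mp hu).2
  have hvc : dist c x ≤ dist v c := hc.le_dist hV hv (by rw [dist_comm]; exact hN x hx)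
  have hdiff : (∀ y, IsDelaunayEdge (nbhd V v) v y → s(v, y) ∉ removedEdges (nbhd V v) v c) →
      E = E \ removedEdges (nbhd V v) v c := by
    intro h0
    refine (sdiff_eq_left.mpr (Set.disjoint_left.mpr fun e he => ?_)).symm
    obtain ⟨y, rfl, hy⟩ := hE he
    exact h0 y hy
  obtain ⟨h2, hn2⟩ := h
  rcases eq_or_ne x v with rfl | hxv
  · have hcard := hc.ncard_self_ne_two hV
    rw [hn2 hcard]
    refine hdiff ?_
    rintro y - ⟨x', hx', hxv', hmin, hcard', -⟩
    obtain ⟨T, hT, h3, hxT, hS, he⟩ := hc.exists_face hV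
    obtain ⟨u, hu, hux⟩ := Finset.exists_mem_ne (s := T) (by omega) x
    have h1 := hmin u (hT hu) hux
    rw [dist_comm c u, hS u hu] at h1
    have hdist : dist c x' = dist c x :=
      le_antisymm h1 (by rw [dist_comm c x']; exact he x' hx')
    rw [hdist] at hcard'
    exact hcard hcard'
  have hxN : ∀ u ∈ nbhd V v, dist u c < dist c x → 1 < dist x u := by
    intro u hu huc
    by_contra! hcon
    exact absurd (hc.le_dist hV (mem_nbhd.mp hu).1 (by rwa [dist_comm])) (not_le.mpr huc)
  by_cases hempty : ∀ u ∈ nbhd V v, dist c x ≤ dist u c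
  · by_cases hcard : ((nbhd V v : Set Plane) ∩ Metric.sphere c (dist c x)).ncard = 2
    · obtain ⟨p, z, hp, hpx, hpc, hz, hz1, hloop⟩ := h2 hcard
      exact hloop.eq_diff hE fun y D hvy hD => mem_removedEdges_iff hN (mem_nbhd_self hv) hx
        hxv hempty hcard hp hpx hpc hz hz1 hvy hD
    · rw [hn2 hcard]
      refine hdiff ?_
      rintro y - ⟨x', hx', hxv', hmin, hcard', -⟩
      have hdist : dist c x' = dist c x :=
        le_antisymm (hmin x hx hxv) (by rw [dist_comm c x']; exact hempty x' hx')
      rw [hdist] at hcard'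
      exact hcard hcard'
  · push Not at hempty
    obtain ⟨q, hq, hqc⟩ := hempty
    have hqv : q ≠ v := by
      rintro rfl
      exact absurd hvc (not_le.mpr hqc)
    have hkeep : E = E \ removedEdges (nbhd V v) v c := by
      refine hdiff ?_
      rintro y ⟨hvy, D, hD⟩ ⟨x', hx', hxv', hmin, -, y', a, -, z, he, ha, -, hz, -, hcross⟩
      rw [← Sym2.congr_right.mp he] at hcross
      have hxc' : dist c x' < dist c x :=
        (hmin q hq hqv).trans_lt (by rwa [dist_comm c q])
      refine not_crosses_of_concentric hN (mem_nbhd_self hv) hvy hx hxv hvc hxN hxc' ?_ hD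
        ha.1 ha.2 hz hcross
      intro u hu
      rcases eq_or_ne u v with rfl | huv
      · exact hxc'.le.trans hvc
      · rw [dist_comm u c]; exact hmin u hu huv
    by_cases hcard : ((nbhd V v : Set Plane) ∩ Metric.sphere c (dist c x)).ncard = 2
    · obtain ⟨p, z, hp, hpx, hpc, hz, hz1, Del, hDel, rfl⟩ := h2 hcard
      rw [← hkeep]
      refine Set.sep_eq_self_iff_mem_true.mpr ?_
      rintro e he ⟨y, rfl, harc, hcross⟩
      have hvy := (mem_initialEdges.mp (hE he)).1
      obtain ⟨w, hwV, hw, hxw⟩ := hc.exists_mem_outerArc hV hcard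
      have hyN := (hDel y he).mem_right
      have hwv : ¬ dist w v ≤ 1 := hw.2
      have hcol : ¬ Collinear ℝ ({v, y, w} : Set Plane) := by
        refine hV.not_collinear hv (mem_nbhd.mp hyN).1 hwV hvy ?_ ?_
        · rintro rfl
          simp at hwv
        · rintro rfl
          exact hwv (hN _ hyN)
      rcases hcross with hcross | hcross
      · exact not_crosses_of_mem_ball hN hvy hx hxv hvc hxN hw hxw hcol hq hqc (hDel y he)
          hx (dist_comm x c) hz harc hcross
      · exact not_crosses_of_mem_ball hN hvy hx hxv hvc hxN hw hxw hcol hq hqc (hDel y he)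
          hp hpc hz harc hcross
    · rw [hn2 hcard, ← hkeep]

end Steps

/-! ### Loops, messages and executions. -/

/-- Successive differences amount to removing a union, which makes the order irrelevant. The bound
`I` is an invariant: a step need only be understood on subsets of the initial edges. -/
lemma Loop.eq_diff {α β : Type} {step : α → Set β → Set β → Prop} {R : α → Set β} {I : Set β}
    {l : List α} {E E₁ : Set β} (hl : Loop step l E E₁)
    (h : ∀ a ∈ l, ∀ E ⊆ I, ∀ E₁, step a E E₁ → E₁ = E \ R a) (hE : E ⊆ I) :
    E₁ = E \ ⋃ a ∈ l, R a := by
  induction hl with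
  | nil => simp
  | @cons a l s t u hst _ ih =>
    have ht := h a (by simp) s hE t hst
    rw [ih (fun b hb => h b (by simp [hb])) (ht ▸ Set.sdiff_subset.trans hE), ht,
      Set.sdiff_sdiff]
    simp

lemma Loop.exists_of_step {α β : Type} {step : α → Set β → Set β → Prop} {I : Set β}
    {l : List α} (h : ∀ a ∈ l, ∀ E ⊆ I, ∃ E₁ ⊆ I, step a E E₁) {E : Set β} (hE : E ⊆ I) :
    ∃ E₁ ⊆ I, Loop step l E E₁ := by
  induction l generalizing E with
  | nil => exact ⟨E, hE, .nil E⟩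
  | cons a l ih =>
    obtain ⟨E₁, h₁, hs⟩ := h a (by simp) E hE
    obtain ⟨E₂, h₂, hl⟩ := ih (fun b hb => h b (by simp [hb])) h₁
    exact ⟨E₂, h₂, .cons hs hl⟩

lemma exists_mem_of_forall₂_left {α β : Type} {r : α → β → Prop} {l : List α} {m : List β}
    (h : List.Forall₂ r l m) {a : α} (ha : a ∈ l) : ∃ b ∈ m, r a b := by
  induction h with
  | nil => simp at ha
  | @cons a' b l m hr _ ih =>
    rcases List.mem_cons.mp ha with rfl | ha
    · exact ⟨b, by simp, hr⟩
    · obtain ⟨b', hb', hr'⟩ := ih ha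
      exact ⟨b', by simp [hb'], hr'⟩

/-- General position makes the circumcenter of each triangle unique, so any two lists that may be
broadcast have the same members. -/
lemma IsCenterList.mem_iff {V : Finset Plane} (hV : GeneralPosition V) {x : Plane}
    {cs : List Plane} (h : IsCenterList (nbhd V x) x cs) (c : Plane) :
    c ∈ cs ↔ IsSentCenter V x c := by
  obtain ⟨Ts, -, hTs, hf⟩ := h
  constructor
  · intro hc
    obtain ⟨T, hT, hr⟩ := exists_mem_of_forall₂_left hf.flip hc
    exact ⟨T, (hTs T).mp hT, hr⟩
  · rintro ⟨T, hT, r, hr⟩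
    obtain ⟨c', hc', r', hr'⟩ := exists_mem_of_forall₂_left hf ((hTs T).mpr hT)
    have : c = c' := hV.center_unique (fun p hp => (mem_nbhd.mp (hT.1.1 hp)).1) hT.1.2.1 hr hr'
    rwa [this]

lemma exists_isCenterList (N : Finset Plane) (v : Plane) : ∃ cs, IsCenterList N v cs := by
  have hfin : (wideFaces N v).Finite :=
    N.powerset.finite_toSet.subset fun T hT => by simpa using hT.1.1
  have : ∀ T, ∃ c : Plane, T ∈ wideFaces N v → ∃ r : ℝ, Circumscribes ⟨c, r⟩ T := by
    intro T
    by_cases hT : T ∈ wideFaces N v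
    · obtain ⟨D, hD, -⟩ := hT.1.2.2
      exact ⟨D.center, fun _ => ⟨D.radius, hD⟩⟩
    · exact ⟨v, fun h => absurd h hT⟩
  choose f hf using this
  refine ⟨hfin.toFinset.toList.map f, hfin.toFinset.toList, Finset.nodup_toList _,
    fun T => by simp, ?_⟩
  rw [List.forall₂_map_right_iff, List.forall₂_same]
  intro T hT
  exact hf T (by simpa using hT)

lemma exists_broadcasts {α : Type} (N : Finset Plane) (v : Plane) (mk : List Plane → α) :
    ∃ out, Broadcasts N v mk out := by
  rcases (wideFaces N v).eq_empty_or_nonempty with h | h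
  · exact ⟨[], Or.inl ⟨h, rfl⟩⟩
  · obtain ⟨cs, hcs⟩ := exists_isCenterList N v
    exact ⟨_, Or.inr ⟨h, cs, hcs, rfl⟩⟩

lemma Broadcasts.exists_of_mem {α : Type} {N : Finset Plane} {v : Plane} {mk : List Plane → α}
    {out : List α} (h : Broadcasts N v mk out) {m : α} (hm : m ∈ out) :
    ∃ cs, IsCenterList N v cs ∧ m = mk cs := by
  rcases h with ⟨-, rfl⟩ | ⟨-, cs, hcs, rfl⟩
  · simp at hm
  · exact ⟨cs, hcs, by simpa using hm⟩

lemma Broadcasts.exists_of_isSentCenter {α : Type} {V : Finset Plane} {x c : Plane}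
    {mk : List Plane → α} {out : List α} (h : Broadcasts (nbhd V x) x mk out)
    (hc : IsSentCenter V x c) : ∃ cs, IsCenterList (nbhd V x) x cs ∧ mk cs ∈ out := by
  rcases h with ⟨he, -⟩ | ⟨-, cs, hcs, rfl⟩
  · obtain ⟨T, hT, -⟩ := hc
    simp [he] at hT
  · exact ⟨cs, hcs, by simp⟩

/-- An algorithm whose reaction to a received center `c` is to remove the edges
`removedEdges N_v v c` can be executed, and its result is determined. -/
theorem execution_of_step {α : Type} {V : Finset Plane} (hV : GeneralPosition V)
    (mk : Plane → List Plane → α) (centers : α → List Plane)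
    (hmk : ∀ x cs, centers (mk x cs) = cs)
    (step : Finset Plane → Plane → α → Plane → Set (Sym2 Plane) → Set (Sym2 Plane) → Prop)
    (hex : ∀ v ∈ V, ∀ x ∈ nbhd V v, ∀ cs c, IsSentCenter V x c →
      ∀ E ⊆ initialEdges (nbhd V v) v, ∃ E₁, step (nbhd V v) v (mk x cs) c E E₁)
    (heq : ∀ v ∈ V, ∀ x ∈ nbhd V v, ∀ cs c, IsSentCenter V x c →
      ∀ E ⊆ initialEdges (nbhd V v) v, ∀ E₁, step (nbhd V v) v (mk x cs) c E E₁ →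
        E₁ = E \ removedEdges (nbhd V v) v c) :
    (∃ E, IsExecution mk (fun N v m => Loop (step N v m) (centers m)) V E) ∧
    ∀ E, IsExecution mk (fun N v m => Loop (step N v m) (centers m)) V E →
      ∀ v ∈ V, E v = initialEdges (nbhd V v) v \
        {e | ∃ x ∈ nbhd V v, ∃ c, IsSentCenter V x c ∧ e ∈ removedEdges (nbhd V v) v c} := by
  have hmem : ∀ {v x}, x ∈ nbhd V v → x ∈ V := fun hx => (mem_nbhd.mp hx).1
  constructor
  · choose out hout using fun v => exists_broadcasts (nbhd V v) v (mk v)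
    have hloop : ∀ v, ∃ E, v ∈ V → Loop (fun m => Loop (step (nbhd V v) v m) (centers m))
        ((nbhd V v).toList.flatMap out) (initialEdges (nbhd V v) v) E := by
      intro v
      by_cases hv : v ∈ V
      swap
      · exact ⟨∅, fun h => absurd h hv⟩
      -- The edge set must stay within the initial edges, since only these are known to have
      -- Delaunay disks to choose.
      suffices h : ∀ m ∈ (nbhd V v).toList.flatMap out, ∀ E ⊆ initialEdges (nbhd V v) v,
          ∃ E₁ ⊆ initialEdges (nbhd V v) v, Loop (step (nbhd V v) v m) (centers m) E E₁ by
        obtain ⟨E, -, hE⟩ := Loop.exists_of_step h subset_rfl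
        exact ⟨E, fun _ => hE⟩
      intro m hm E hE
      obtain ⟨x, hx, hm⟩ := List.mem_flatMap.mp hm
      rw [Finset.mem_toList] at hx
      obtain ⟨cs, hcs, rfl⟩ := (hout x).exists_of_mem hm
      refine Loop.exists_of_step (fun c hc E hE => ?_) hE
      rw [hmk, hcs.mem_iff hV] at hc
      obtain ⟨E₁, hE₁⟩ := hex v hv x hx cs c hc E hE
      exact ⟨E₁, heq v hv x hx cs c hc E hE E₁ hE₁ ▸ Set.sdiff_subset.trans hE, hE₁⟩
    choose E hE using hloop
    exact ⟨E, out, _, fun v hv => ⟨hout v, List.Perm.refl _, hE v hv⟩⟩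
  · rintro E ⟨out, inbox, hio⟩ v hv
    obtain ⟨-, hperm, hloop⟩ := hio v hv
    have hin : ∀ m, m ∈ inbox v ↔ ∃ x ∈ nbhd V v, m ∈ out x := by
      intro m
      rw [hperm.mem_iff, List.mem_flatMap]
      simp
    rw [hloop.eq_diff (R := fun m => ⋃ c ∈ centers m, removedEdges (nbhd V v) v c) ?_
      subset_rfl]
    · congr 1
      ext e
      simp only [Set.mem_iUnion, Set.mem_ofPred_eq, exists_prop, hin]
      constructor
      · rintro ⟨m, ⟨x, hx, hm⟩, c, hc, he⟩
        obtain ⟨cs, hcs, rfl⟩ := (hio x (hmem hx)).1.exists_of_mem hm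
        rw [hmk, hcs.mem_iff hV] at hc
        exact ⟨x, hx, c, hc, he⟩
      · rintro ⟨x, hx, c, hc, he⟩
        obtain ⟨cs, hcs, hm⟩ := (hio x (hmem hx)).1.exists_of_isSentCenter hc
        exact ⟨_, ⟨x, hx, hm⟩, c, by rwa [hmk, hcs.mem_iff hV], he⟩
    · intro m hm E hE E₁ hl
      obtain ⟨x, hx, hm⟩ := (hin m).mp hm
      obtain ⟨cs, hcs, rfl⟩ := (hio x (hmem hx)).1.exists_of_mem hm
      refine hl.eq_diff (fun c hc E hE E₁ hs => ?_) hE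
      rw [hmk, hcs.mem_iff hV] at hc
      exact heq v hv x hx cs c hc E hE E₁ hs

theorem mainTheorem6 (V : Finset Plane) (hV : GeneralPosition V) :
    (∃ E, IsPLDGExecution V E) ∧ (∃ E, IsAnonExecution V E) ∧
    ∀ E E' : Plane → Set (Sym2 Plane), IsPLDGExecution V E → IsAnonExecution V E' →
      (∀ v ∈ V, ∀ y, IsDelaunayEdge (nbhd V v) v y →
        (s(v, y) ∉ E v ↔ s(v, y) ∉ E' v)) ∧
      unionGraph V E = unionGraph V E' := by
  obtain ⟨hex, heq⟩ := execution_of_step (α := Plane × List Plane) hV (fun v cs => (v, cs))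
    Prod.snd (fun _ _ => rfl) (fun N v m => pldgCenterStep N v m.1)
    (fun v _ x _ _ c hc E hE => exists_pldgCenterStep hV hc hE)
    (fun v hv x hx _ c hc E hE E₁ h => pldgCenterStep_eq hV hv hx hc hE h)
  obtain ⟨hex', heq'⟩ := execution_of_step (α := List Plane) hV (fun _ cs => cs)
    id (fun _ _ => rfl) (fun N v _ => anonCenterStep N v)
    (fun v _ x hx _ c hc E hE => exists_anonCenterStep hV hx hc hE)
    (fun v hv x hx _ c hc E hE E₁ h => anonCenterStep_eq hV hv hx hc hE h)
  refine ⟨hex, hex', fun E E' hE hE' => ?_⟩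
  have h : ∀ v ∈ V, E v = E' v := fun v hv => (heq E hE v hv).trans (heq' E' hE' v hv).symm
  refine ⟨fun v hv y _ => by rw [h v hv], ?_⟩
  have hU : ⋃ v ∈ V, E v = ⋃ v ∈ V, E' v := Set.iUnion₂_congr h
  unfold unionGraph
  rw [hU]
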